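/- Let $G_1^n$ be the Bollobás–Riordan preferential attachment graph with one edge per vertex: $G_1^0$ is the graph with no vertices, and for $t\ge 1$ the graph $G_1^t$ is obtained from $G_1^{t-1}$ by adding the vertex $t$ and one edge between $t$ and a random vertex $i\in\{1,\dots,t\}$, where, given $G_1^{t-1}$, $\Pr(i=s)=d_{G_1^{t-1}}(s)/(2t-1)$ for $1\le s\le t-1$ and $\Pr(i=t)=1/(2t-1)$; here $d_G(s)$ is the degree of $s$ in $G$, a loop being counted twice. The second degree of a vertex $t$ of $G_1^n$ is the number of edges $ij$ of $G_1^n$ (loops allowed, each edge counted once) such that $i\ne t$, $j\ne t$ and $it$ is an edge of $G_1^n$. Let $M_n^2(k)$ be the expected number of vertices of $G_1^n$ whose second degree equals $k$. Then, for all integers $n\ge 1$ and $k>1$, $$M_n^2(k)=\frac{4n}{k^2}\left(1+O\left(\frac{\ln^2 k}{k}\right)+O\left(\frac{k^2}{n}\right)\right),$$ where the constants implied by the $O$-terms are absolute (they depend neither on $n$ nor on $k$). -/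

import Mathlib

open scoped ENNReal

/-- An undirected graph with vertex set `{1, …, n}` and exactly `n` edges, loops being allowed.
(Multiple edges never occur in the process below: each new edge contains the new vertex.) -/
@[ext]
structure LoopGraph (n : ℕ) where
  /-- the set of edges; a loop at `v` is the unordered pair `s(v, v)` -/
  edges : Finset (Sym2 ℕ)
  mem_vertices : ∀ e ∈ edges, ∀ v ∈ e, v ∈ Finset.Icc 1 n
  card_edges : edges.card = n

namespace LoopGraph

/-- The degree of the vertex `s`: the number of edges at `s`, a loop being counted twice. -/
def degree {n : ℕ} (G : LoopGraph n) (s : ℕ) : ℕ :=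
  (G.edges.filter (fun e => s ∈ e)).card + if s(s, s) ∈ G.edges then 1 else 0

open Classical in
/-- The second degree of the vertex `t`: the number of edges `ij` of the graph with
`i ≠ t`, `j ≠ t` such that `it` is an edge of the graph. -/
noncomputable def secondDegree {n : ℕ} (G : LoopGraph n) (t : ℕ) : ℕ :=
  (G.edges.filter
    (fun e => ∃ i j : ℕ, e = s(i, j) ∧ i ≠ t ∧ j ≠ t ∧ s(i, t) ∈ G.edges)).card

/-- The number of vertices with second degree `k`. -/
noncomputable def numSecondDegree {n : ℕ} (G : LoopGraph n) (k : ℕ) : ℕ :=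
  ((Finset.Icc 1 n).filter (fun t => G.secondDegree t = k)).card

/-- The graph with no vertices. -/
def empty : LoopGraph 0 where
  edges := ∅
  mem_vertices := by simp
  card_edges := by simp

theorem sum_degree {n : ℕ} (G : LoopGraph n) :
    ∑ s ∈ Finset.Icc 1 n, G.degree s = 2 * n := by
  have key : ∀ s, G.degree s =
      ∑ e ∈ G.edges, ((if s ∈ e then 1 else 0) + if e = s(s, s) then 1 else 0) := by
    intro s
    rw [degree, Finset.sum_add_distrib, Finset.card_filter, Finset.sum_ite_eq']
  simp_rw [key]
  rw [Finset.sum_comm]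
  have h : ∀ e ∈ G.edges, ∑ s ∈ Finset.Icc 1 n,
      ((if s ∈ e then 1 else 0) + if e = s(s, s) then 1 else 0) = 2 := by
    intro e he
    have hm := G.mem_vertices e he
    induction e using Sym2.ind with
    | _ a b =>
      have ha : a ∈ Finset.Icc 1 n := hm a (by simp)
      have hb : b ∈ Finset.Icc 1 n := hm b (by simp)
      have e1 : ∀ s, ((if s ∈ s(a, b) then 1 else 0) + if s(a, b) = s(s, s) then 1 else 0 : ℕ)
          = (if a = s then 1 else 0) + (if b = s then 1 else 0) := by
        intro s
        simp only [Sym2.mem_iff, Sym2.eq_iff]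
        split_ifs <;> first | rfl | (exfalso; grind)
      simp_rw [e1]
      rw [Finset.sum_add_distrib, Finset.sum_ite_eq, Finset.sum_ite_eq, if_pos ha, if_pos hb]
  rw [Finset.sum_congr rfl h, Finset.sum_const, G.card_edges, smul_eq_mul, mul_comm]

/-- Add the vertex `t + 1` and an edge between `t + 1` and `i`. -/
def addEdge {t : ℕ} (G : LoopGraph t) (i : Finset.Icc 1 (t + 1)) : LoopGraph (t + 1) where
  edges := insert s(t + 1, (i : ℕ)) G.edges
  mem_vertices := by
    intro e he v hv
    rw [Finset.mem_insert] at he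
    rcases he with rfl | he
    · rcases Sym2.mem_iff.1 hv with rfl | rfl
      · simp
      · exact i.2
    · have := Finset.mem_Icc.1 (G.mem_vertices e he v hv)
      exact Finset.mem_Icc.2 ⟨this.1, by omega⟩
  card_edges := by
    rw [Finset.card_insert_of_notMem, G.card_edges]
    intro h
    have := Finset.mem_Icc.1 (G.mem_vertices _ h (t + 1) (by simp))
    omega

/-- The probability that the new vertex `t + 1` is joined to `s`:
`d(s) / (2(t+1) - 1)` for `s ≤ t`, and `1 / (2(t+1) - 1)` for `s = t + 1`. -/
noncomputable def attachProb {t : ℕ} (G : LoopGraph t) (s : ℕ) : ℝ≥0∞ :=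
  if s ≤ t then (G.degree s : ℝ≥0∞) / ((2 * t + 1 : ℕ) : ℝ≥0∞)
  else 1 / ((2 * t + 1 : ℕ) : ℝ≥0∞)

theorem sum_attachProb {t : ℕ} (G : LoopGraph t) :
    ∑ s : Finset.Icc 1 (t + 1), G.attachProb s = 1 := by
  rw [Finset.sum_coe_sort (Finset.Icc 1 (t + 1)) (fun s => G.attachProb s),
    Finset.sum_Icc_succ_top (by omega)]
  have h : ∀ s ∈ Finset.Icc 1 t,
      G.attachProb s = (G.degree s : ℝ≥0∞) * ((2 * t + 1 : ℕ) : ℝ≥0∞)⁻¹ := by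
    intro s hs
    rw [attachProb, if_pos (Finset.mem_Icc.1 hs).2, div_eq_mul_inv]
  rw [Finset.sum_congr rfl h, ← Finset.sum_mul, ← Nat.cast_sum, G.sum_degree, attachProb,
    if_neg (by omega), div_eq_mul_inv, ← add_mul, ← Nat.cast_add_one]
  exact ENNReal.mul_inv_cancel (Nat.cast_ne_zero.2 (Nat.succ_ne_zero (2 * t))) (ENNReal.natCast_ne_top _)

/-- The law of the vertex to which the new vertex `t + 1` is joined. -/
noncomputable def attachLaw {t : ℕ} (G : LoopGraph t) : PMF (Finset.Icc 1 (t + 1)) :=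
  PMF.ofFintype (fun s => G.attachProb s) G.sum_attachProb

end LoopGraph

/-- The law of the random graph `G_1^n`. -/
noncomputable def prefAttach : (n : ℕ) → PMF (LoopGraph n)
  | 0 => PMF.pure LoopGraph.empty
  | t + 1 => (prefAttach t).bind fun G => G.attachLaw.map G.addEdge

/-- The expected number of vertices of `G_1^n` with second degree `k`
(a bounded random variable with finitely many values, so that the sum converges). -/
noncomputable def expectedSecondDegree (n k : ℕ) : ℝ :=
  ∑' G : LoopGraph n, (prefAttach n G).toReal * (G.numSecondDegree k : ℝ)

/-! Attach to each vertex its degree d, its second degree k and the sum K of the degrees of its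
other neighbours. A new edge at the vertex itself raises d and K by one; a new edge at a neighbour
raises k and K by one. So κ = K - d - k is frozen at birth: it is 0, 1 or -2 according as the vertex
first attached to a loopless vertex, to another vertex with a loop, or to itself. For fixed κ the
counts `jointCount n κ d k` therefore obey a closed linear recursion (`jointCount_succ`) whose
source involves only degree counts.

For κ = 0, replacing the source by its limit makes (n + 1/2) * `limitDensity` an exact solution,
because (n + 1/2) / (2n + 1) = 1/2. The degree counts are within O(1/d) of their limit
(`abs_plainCount_sub_le`), and 4 / ((d + 1)(d + 2)) dominates the resulting error uniformly in n and
k (`abs_jointCount_sub_le`). The classes κ = 1 and κ = -2 are bounded by a similar weight. These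
weights are summable in d, so the total error is O(1) (`abs_expectedSecondDegree_sub_le`), which is
the relative error O(k²/n).

It remains to see that the limiting mass at k is 4/k² up to a relative error O(ln²k / k). Summing
the limit recursion over d and multiplying by (k + 1)(k + 2) makes it telescope (`mass_telescope`)
with source tending to 4. The perturbation is the first moment in d, which is O(ln k / k²) by
`moment_le`; weighted by j + 1 and summed over j < k it contributes O(ln²k). -/

/-! ### The limit recursion: pointwise bounds and partial sums in k -/

/-- The rate at which new vertices of degree one and second degree `k` appear. -/
noncomputable def birthRate (k : ℕ) : ℝ := if k = 0 then 0 else 4 / ((k + 1) * (k + 2))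

/-- The limiting proportion of vertices of degree `d` and second degree `k`. -/
noncomputable def limitDensity : ℕ → ℕ → ℝ
  | 0, _ => 0
  | _ + 1, 0 => 0
  | d + 1, k + 1 => (d * limitDensity d (k + 1) + (d + k + 1) * limitDensity (d + 1) k +
      if d = 0 then birthRate (k + 1) else 0) / (2 * d + k + 5)
termination_by d k => (d, k)

namespace limitDensity

@[simp] theorem zero_left (k : ℕ) : limitDensity 0 k = 0 := by rw [limitDensity]

@[simp] theorem zero_right (d : ℕ) : limitDensity d 0 = 0 := by
  cases d <;> rw [limitDensity]

theorem succ_succ (d k : ℕ) :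
    (2 * d + k + 5) * limitDensity (d + 1) (k + 1) =
      d * limitDensity d (k + 1) + (d + k + 1) * limitDensity (d + 1) k +
        if d = 0 then birthRate (k + 1) else 0 := by
  rw [limitDensity, mul_div_cancel₀]
  positivity

theorem birthRate_succ (k : ℕ) : birthRate (k + 1) = 4 / ((k + 2) * (k + 3)) := by
  rw [birthRate, if_neg (Nat.succ_ne_zero k)]
  push_cast
  ring_nf

theorem birthRate_nonneg (k : ℕ) : 0 ≤ birthRate k := by
  rw [birthRate]; split_ifs <;> positivity

theorem nonneg (d k : ℕ) : 0 ≤ limitDensity d k := by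
  induction d generalizing k with
  | zero => simp
  | succ d ihd =>
    induction k with
    | zero => simp
    | succ k ihk =>
      have h := succ_succ d k
      have h1 := mul_nonneg (Nat.cast_nonneg (α := ℝ) d) (ihd (k + 1))
      have h2 : 0 ≤ ((d : ℝ) + k + 1) * limitDensity (d + 1) k := by positivity
      have h3 : (0 : ℝ) ≤ if d = 0 then birthRate (k + 1) else 0 := by
        split_ifs
        · exact birthRate_nonneg _
        · exact le_rfl
      refine nonneg_of_mul_nonneg_right (a := (2 * d + k + 5 : ℝ)) ?_ (by positivity)
      rw [h]
      linarith

/-- The bound w solves d * w d = (d + 4) * w (d + 1), so, being constant in k, it solves the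
recursion exactly away from the source. It controls the degrees above k and the truncation at D. -/
theorem le_quartic (d k : ℕ) :
    limitDensity (d + 1) k ≤ 4 / ((d + 1) * (d + 2) * (d + 3) * (d + 4)) := by
  induction d generalizing k with
  | zero =>
    induction k with
    | zero => rw [zero_right]; positivity
    | succ k ihk =>
      have h := succ_succ 0 k
      have hs : birthRate (k + 1) ≤ 2 / 3 := by
        rw [birthRate_succ, div_le_div_iff₀ (by positivity) (by norm_num)]
        nlinarith [(Nat.cast_nonneg k : (0 : ℝ) ≤ k)]
      norm_num at h ihk ⊢
      have : ((k : ℝ) + 1) * limitDensity 1 k ≤ (k + 1) * (1 / 6) := by gcongr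
      nlinarith [(Nat.cast_nonneg k : (0 : ℝ) ≤ k)]
  | succ d ihd =>
    induction k with
    | zero => rw [zero_right]; positivity
    | succ k ihk =>
      have h := succ_succ (d + 1) k
      rw [if_neg (Nat.succ_ne_zero d)] at h
      have h1 := mul_le_mul_of_nonneg_left (ihd (k + 1)) (by positivity : (0 : ℝ) ≤ (d + 1))
      have h2 := mul_le_mul_of_nonneg_left ihk (by positivity : (0 : ℝ) ≤ (d + 1) + k + 1)
      push_cast at h h1 h2 ⊢
      refine le_of_mul_le_mul_left (a := (2 * (d + 1) + k + 5 : ℝ)) ?_ (by positivity)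
      rw [h]
      refine le_trans (by linarith) (le_of_eq ?_) (b := ((d:ℝ) + 1) *
        (4 / ((d + 1) * (d + 2) * (d + 3) * (d + 4))) + ((d + 1) + k + 1) *
        (4 / ((d + 1 + 1) * (d + 1 + 2) * (d + 1 + 3) * (d + 1 + 4))))
      field_simp
      ring

/-- A supersolution with an extra factor 1 / (2d + k + 4). That factor later absorbs n + 1/2 where
2d + k is too large for the graph. -/
theorem le_size (d k : ℕ) :
    limitDensity (d + 1) k ≤ 4 / ((d + 1) * (d + 2) * (2 * d + k + 4)) := by
  induction d generalizing k with
  | zero =>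
    induction k with
    | zero => rw [zero_right]; positivity
    | succ k ihk =>
      have h := succ_succ 0 k
      have hs : birthRate (k + 1) ≤ 6 / (k + 4) := by
        rw [birthRate_succ, div_le_div_iff₀ (by positivity) (by positivity)]
        nlinarith [(Nat.cast_nonneg k : (0 : ℝ) ≤ k)]
      have h2 := mul_le_mul_of_nonneg_left ihk (by positivity : (0 : ℝ) ≤ k + 1)
      norm_num at h ihk h2 ⊢
      refine le_of_mul_le_mul_left (a := (k + 5 : ℝ)) ?_ (by positivity)
      rw [h]
      refine le_trans (by linarith) (le_of_eq ?_) (b := ((k : ℝ) + 1) * (4 / (2 * (k + 4))) +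
        6 / (k + 4))
      field_simp
      ring
  | succ d ihd =>
    induction k with
    | zero => rw [zero_right]; positivity
    | succ k ihk =>
      have h := succ_succ (d + 1) k
      rw [if_neg (Nat.succ_ne_zero d)] at h
      have h1 := mul_le_mul_of_nonneg_left (ihd (k + 1)) (by positivity : (0 : ℝ) ≤ (d + 1))
      have h2 := mul_le_mul_of_nonneg_left ihk (by positivity : (0 : ℝ) ≤ (d + 1) + k + 1)
      push_cast at h h1 h2 ⊢
      refine le_of_mul_le_mul_left (a := (2 * (d + 1) + k + 5 : ℝ)) ?_ (by positivity)
      rw [h]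
      have h3 : ((d : ℝ) + 1 + k + 1) *
          (4 / ((d + 1 + 1) * (d + 1 + 2) * (2 * (d + 1) + k + 4))) ≤ ((d : ℝ) + 1 + k + 1) *
          (4 / ((d + 1 + 1) * (d + 1 + 2) * (2 * d + k + 5))) := by
        gcongr ?_ * (4 / (?_ * ?_))
        linarith
      refine le_trans (by linarith) (le_of_eq ?_) (b := ((d:ℝ) + 1) *
        (4 / ((d + 1) * (d + 2) * (2 * d + (k + 1) + 4))) + ((d : ℝ) + 1 + k + 1) *
          (4 / ((d + 1 + 1) * (d + 1 + 2) * (2 * d + k + 5))))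
      have : (2 * (d : ℝ) + (k + 1) + 4) = 2 * d + k + 5 := by ring
      rw [this]
      field_simp
      ring

theorem sum_birthRate (k : ℕ) : ∑ j ∈ Finset.range (k + 1), birthRate j = 2 - 4 / (k + 2) := by
  induction k with
  | zero => norm_num [birthRate]
  | succ k ih =>
    rw [Finset.sum_range_succ, ih, birthRate_succ]
    push_cast
    field_simp
    ring

/-- Summing over second degrees up to k cancels the internal transitions; only the flux (d + 1 + k)
* `limitDensity (d + 1) k` out of the top level survives. -/
theorem sum_rec (d k : ℕ) :
    (d + 3) * ∑ j ∈ Finset.range (k + 1), limitDensity (d + 1) j +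
        (d + 1 + k) * limitDensity (d + 1) k =
      d * ∑ j ∈ Finset.range (k + 1), limitDensity d j +
        if d = 0 then ∑ j ∈ Finset.range (k + 1), birthRate j else 0 := by
  induction k with
  | zero => simp [birthRate]
  | succ k ih =>
    rw [Finset.sum_range_succ, Finset.sum_range_succ _ (k + 1), Finset.sum_range_succ _ (k + 1)]
    have h := succ_succ d k
    push_cast
    split_ifs at h ih ⊢ <;> linarith

theorem sum_le (d k : ℕ) :
    ∑ j ∈ Finset.range (k + 1), limitDensity (d + 1) j ≤ 4 / ((d + 1) * (d + 2) * (d + 3)) := by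
  induction d with
  | zero =>
    have h := sum_rec 0 k
    rw [if_pos rfl, sum_birthRate] at h
    have h1 : 0 ≤ (((0 : ℕ) : ℝ) + 1 + k) * limitDensity (0 + 1) k :=
      mul_nonneg (by positivity) (nonneg _ _)
    have h2 : (0 : ℝ) ≤ 4 / (k + 2) := by positivity
    norm_num at h h1 ⊢
    linarith
  | succ d ih =>
    have h := sum_rec (d + 1) k
    rw [if_neg (Nat.succ_ne_zero d)] at h
    have h1 : 0 ≤ (((d + 1 : ℕ) : ℝ) + 1 + k) * limitDensity (d + 1 + 1) k :=
      mul_nonneg (by positivity) (nonneg _ _)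
    have h2 := mul_le_mul_of_nonneg_left ih (by positivity : (0 : ℝ) ≤ (d + 1))
    push_cast at h h1 h2 ⊢
    refine le_of_mul_le_mul_left (a := (d + 1 + 3 : ℝ)) ?_ (by positivity)
    refine le_trans (by linarith) (le_of_eq ?_) (b := ((d:ℝ) + 1) *
        (4 / ((d + 1) * (d + 2) * (d + 3))))
    field_simp
    ring

/-- The weight j + 1 is chosen so that the flux at level k carries the factor k + 2, at the price of
an unweighted sum that `sum_le` controls. -/
theorem weightedSum_rec (d k : ℕ) :
    (d + 2) * ∑ j ∈ Finset.range (k + 1), (j + 1) * limitDensity (d + 1) j +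
        (k + 2) * (d + 1 + k) * limitDensity (d + 1) k =
      d * ∑ j ∈ Finset.range (k + 1), (j + 1) * limitDensity d j +
        d * ∑ j ∈ Finset.range (k + 1), limitDensity (d + 1) j +
        if d = 0 then ∑ j ∈ Finset.range (k + 1), (j + 1) * birthRate j else 0 := by
  induction k with
  | zero => simp [birthRate]
  | succ k ih =>
    rw [Finset.sum_range_succ, Finset.sum_range_succ _ (k + 1), Finset.sum_range_succ _ (k + 1),
      Finset.sum_range_succ _ (k + 1)]
    have h := succ_succ d k
    push_cast
    split_ifs at h ih ⊢ <;> linear_combination ih + (k + 2 : ℝ) * h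

/-- Multiplying `weightedSum_rec` by d + 1 makes the weighted sums telescope in d. The accumulated
fluxes, which majorise a first moment in d, are thus bounded by two logarithmic sums. -/
theorem weightedSum_telescope (D k : ℕ) :
    D * (D + 1) * ∑ j ∈ Finset.range (k + 1), (j + 1) * limitDensity D j +
        ∑ d ∈ Finset.range D, (d + 1) * ((k + 2) * (d + 1 + k) * limitDensity (d + 1) k) ≤
      ∑ j ∈ Finset.range (k + 1), (j + 1) * birthRate j +
        ∑ d ∈ Finset.range D, 4 / ((d : ℝ) + 2) := by
  induction D with
  | zero =>
    simp only [Nat.cast_zero, zero_mul, Finset.range_zero, Finset.sum_empty, add_zero]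
    exact Finset.sum_nonneg fun j _ => mul_nonneg (by positivity) (birthRate_nonneg j)
  | succ D ih =>
    rw [Finset.sum_range_succ _ D, Finset.sum_range_succ _ D]
    have h := weightedSum_rec D k
    have hP : (D + 1) * (D * ∑ j ∈ Finset.range (k + 1), limitDensity (D + 1) j) ≤
        4 / ((D : ℝ) + 2) := by
      have := mul_le_mul_of_nonneg_left (sum_le D k) (by positivity : (0 : ℝ) ≤ (D + 1) * D)
      rw [← mul_assoc]
      refine this.trans ?_
      rw [mul_div_assoc', div_le_div_iff₀ (by positivity) (by positivity)]
      have hD : (0 : ℝ) ≤ D := by positivity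
      have : 0 ≤ (D + 1 : ℝ) * (D + 2) := by positivity
      nlinarith
    have h' := congrArg (fun x : ℝ => (D + 1) * x) h
    have hs : (0 : ℝ) ≤ ∑ j ∈ Finset.range (k + 1), (j + 1) * birthRate j :=
      Finset.sum_nonneg fun j _ => mul_nonneg (by positivity) (birthRate_nonneg j)
    push_cast
    rcases Nat.eq_zero_or_pos D with rfl | hD
    · simp at h' hP ih ⊢
      linarith
    · rw [if_neg hD.ne'] at h'
      linarith

/-! ### Mass and first moment over the degree -/

/-- The part of the limiting mass of the second degree `k` with degree at most `D`. -/
noncomputable def mass (D k : ℕ) : ℝ := ∑ d ∈ Finset.range D, limitDensity (d + 1) k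

/-- The truncated first moment of the degree at the second degree `k`. -/
noncomputable def moment (D k : ℕ) : ℝ := ∑ d ∈ Finset.range D, (d + 1) * limitDensity (d + 1) k

/-- The harmonic numbers. -/
noncomputable def harm (k : ℕ) : ℝ := ∑ i ∈ Finset.range k, 1 / ((i : ℝ) + 1)

theorem harm_succ (k : ℕ) : harm (k + 1) = harm k + 1 / ((k : ℝ) + 1) := Finset.sum_range_succ _ _

theorem harm_nonneg (k : ℕ) : 0 ≤ harm k := Finset.sum_nonneg fun _ _ => by positivity

theorem harm_mono {j k : ℕ} (h : j ≤ k) : harm j ≤ harm k :=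
  Finset.sum_le_sum_of_subset_of_nonneg (Finset.range_mono h) fun _ _ _ => by positivity

theorem one_le_harm {k : ℕ} (h : 1 ≤ k) : 1 ≤ harm k := by
  refine le_trans (by norm_num [harm]) (harm_mono h)

theorem harm_le (k : ℕ) : harm k ≤ 1 + Real.log k := by
  have := harmonic_le_one_add_log k
  rw [harmonic] at this
  push_cast at this
  simpa [harm] using this

theorem sum_inv_le (k : ℕ) : ∑ d ∈ Finset.range k, 4 / ((d : ℝ) + 2) ≤ 4 * harm k := by
  rw [harm, Finset.mul_sum]
  refine Finset.sum_le_sum fun i _ => ?_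
  rw [mul_one_div]
  gcongr
  norm_num

theorem moment_nonneg (D k : ℕ) : 0 ≤ moment D k :=
  Finset.sum_nonneg fun _ _ => mul_nonneg (by positivity) (nonneg _ _)

/-- Since d + 1 + k ≥ k + 1, the fluxes of `weightedSum_telescope` dominate (k + 1)(k + 2) times the
moment. Each of the two logarithmic sums costs 4 * `harm (k + 1)`. -/
theorem moment_le_of_eq (k : ℕ) : (k + 1) * (k + 2) * moment k k ≤ 8 * harm (k + 1) := by
  have h := weightedSum_telescope k k
  have h1 : 0 ≤ (k : ℝ) * (k + 1) * ∑ j ∈ Finset.range (k + 1), (j + 1) * limitDensity k j :=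
    mul_nonneg (by positivity) (Finset.sum_nonneg fun _ _ => mul_nonneg (by positivity) (nonneg _ _))
  have h2 : ∑ j ∈ Finset.range (k + 1), (j + 1) * birthRate j ≤ 4 * harm (k + 1) := by
    refine le_trans (Finset.sum_le_sum fun j _ => ?_) (sum_inv_le (k + 1))
    rw [birthRate]
    split_ifs
    · rw [mul_zero]; positivity
    · exact le_of_eq (by field_simp)
  have h3 := sum_inv_le k
  have h4 := harm_mono (Nat.le_succ k)
  have h5 : (k + 1) * (k + 2) * moment k k ≤
      ∑ d ∈ Finset.range k, (d + 1) * ((k + 2) * (d + 1 + k) * limitDensity (d + 1) k) := by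
    rw [moment, Finset.mul_sum]
    refine Finset.sum_le_sum fun d _ => ?_
    have : 0 ≤ (d + 1) * limitDensity (d + 1) k * (k + 2) * d :=
      mul_nonneg (mul_nonneg (mul_nonneg (by positivity) (nonneg _ _)) (by positivity))
        (by positivity)
    linarith
  rw [Nat.succ_eq_add_one] at h4
  linarith

/-- Degrees above k: the terms of the moment are bounded through `le_quartic`, and that bound
telescopes. -/
theorem moment_sub_le (k m : ℕ) :
    moment (k + m) k - moment k k ≤
      2 / ((k + 2) * (k + 3)) - 2 / (((k + m : ℕ) + 2) * ((k + m : ℕ) + 3)) := by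
  induction m with
  | zero => simp
  | succ m ih =>
    rw [← add_assoc, moment, Finset.sum_range_succ, ← moment]
    have h := mul_le_mul_of_nonneg_left (le_quartic (k + m) k)
      (by positivity : (0 : ℝ) ≤ (k + m : ℕ) + 1)
    generalize hx : ((k + m : ℕ) : ℝ) = x at *
    have hx0 : 0 ≤ x := hx ▸ Nat.cast_nonneg _
    have : (x + 1) * (4 / ((x + 1) * (x + 2) * (x + 3) * (x + 4))) =
        2 / ((x + 2) * (x + 3)) - 2 / ((x + 1 + 2) * (x + 1 + 3)) := by
      field_simp
      ring
    push_cast at hx ⊢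
    rw [hx]
    linarith

theorem moment_le {D k : ℕ} (h : k ≤ D) : (k + 1) * (k + 2) * moment D k ≤ 10 * harm (k + 1) := by
  obtain ⟨m, rfl⟩ := Nat.exists_eq_add_of_le h
  have h1 := moment_le_of_eq k
  have h2 := moment_sub_le k m
  have h3 : (0 : ℝ) ≤ 2 / (((k + m : ℕ) + 2) * ((k + m : ℕ) + 3)) := by positivity
  have h4 : (k + 1) * (k + 2) * (moment (k + m) k - moment k k) ≤
      ((k : ℝ) + 1) * (k + 2) * (2 / ((k + 2) * (k + 3))) := by
    gcongr
    linarith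
  have h5 : ((k : ℝ) + 1) * (k + 2) * (2 / ((k + 2) * (k + 3))) ≤ 2 := by
    rw [mul_div_assoc', div_le_iff₀ (by positivity)]
    nlinarith [(Nat.cast_nonneg k : (0 : ℝ) ≤ k)]
  have h6 := one_le_harm (Nat.le_add_left 1 k)
  linarith

/-- The recursion summed over the degree; D * `limitDensity D (k + 1)` is the outflow through the
cutoff D, kept so that only finite sums occur. -/
theorem mass_rec (D k : ℕ) :
    (k + 3) * mass D (k + 1) + moment D (k + 1) + D * limitDensity D (k + 1) =
      k * mass D k + moment D k + if D = 0 then 0 else birthRate (k + 1) := by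
  induction D with
  | zero => simp [mass, moment]
  | succ D ih =>
    simp only [mass, moment, Finset.sum_range_succ] at ih ⊢
    have h := succ_succ D k
    push_cast
    split_ifs at h ih <;> linarith

theorem mass_telescope {D : ℕ} (hD : D ≠ 0) (k : ℕ) :
    k * (k + 1) * (k + 2) * mass D k + k * (k + 1) * moment D k =
      ∑ j ∈ Finset.range k, (4 * ((j : ℝ) + 1) / (j + 3) + 2 * ((j + 1) * moment D j) -
        (j + 1) * (j + 2) * (D * limitDensity D (j + 1))) := by
  induction k with
  | zero => simp
  | succ k ih =>
    rw [Finset.sum_range_succ, ← ih]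
    have h := mass_rec D k
    rw [if_neg hD, birthRate_succ] at h
    have hs : 4 * ((k : ℝ) + 1) / (k + 3) = (k + 1) * (k + 2) * (4 / ((k + 2) * (k + 3))) := by
      field_simp
    rw [hs]
    push_cast
    linear_combination ((k : ℝ) + 1) * (k + 2) * h

theorem mass_asymptotic {D k : ℕ} (hk : 1 ≤ k) (hD : k ≤ D) :
    |k * (k + 1) * (k + 2) * mass D k - 4 * k| ≤
      48 * harm k ^ 2 + 4 * k * (k * (k + 1)) / D ^ 3 := by
  have hD0 : D ≠ 0 := by omega
  have h := mass_telescope hD0 k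
  have h1 := one_le_harm hk
  -- Each summand of `mass_telescope` is 4 up to O(`harm k` / (j + 1)) plus the cutoff term; summing
  -- 1 / (j + 1) yields the second harmonic factor.
  have hterm : ∀ j ∈ Finset.range k,
      |4 * ((j : ℝ) + 1) / (j + 3) + 2 * ((j + 1) * moment D j) -
        (j + 1) * (j + 2) * (D * limitDensity D (j + 1)) - 4| ≤
      (8 + 20 * harm k) * (1 / ((j : ℝ) + 1)) + 4 * (k * (k + 1)) / D ^ 3 := by
    intro j hj
    have hjk := Finset.mem_range.1 hj
    have e1 : 4 * ((j : ℝ) + 1) / (j + 3) - 4 = - (8 / (j + 3)) := by field_simp; ring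
    have e2 : 8 / ((j : ℝ) + 3) ≤ 8 * (1 / (j + 1)) := by
      rw [mul_one_div]; gcongr; norm_num
    have e2' : 0 ≤ 8 / ((j : ℝ) + 3) := by positivity
    have e3 : ((j : ℝ) + 1) * moment D j ≤ 10 * harm k * (1 / (j + 1)) := by
      have := moment_le (hjk.le.trans hD)
      have hm := harm_mono (Nat.succ_le_of_lt hjk)
      rw [mul_one_div, le_div_iff₀ (by positivity)]
      have : ((j : ℝ) + 1) * moment D j * (j + 1) ≤ (j + 1) * (j + 2) * moment D j := by
        have := mul_nonneg (by positivity : (0 : ℝ) ≤ j + 1) (moment_nonneg D j)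
        linarith
      rw [Nat.succ_eq_add_one] at hm
      linarith
    have e3' : 0 ≤ ((j : ℝ) + 1) * moment D j := mul_nonneg (by positivity) (moment_nonneg _ _)
    have e4 : ((j : ℝ) + 1) * (j + 2) * (D * limitDensity D (j + 1)) ≤
        4 * (k * (k + 1)) / D ^ 3 := by
      obtain ⟨D, rfl⟩ := Nat.exists_eq_succ_of_ne_zero hD0
      have hb := le_quartic D (j + 1)
      have hjk' : (j : ℝ) + 1 ≤ k := by exact_mod_cast hjk
      have hc : ((D + 1 : ℕ) : ℝ) * limitDensity (D + 1) (j + 1) ≤ 4 / ((D + 1 : ℕ) : ℝ) ^ 3 := by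
        push_cast
        calc ((D : ℝ) + 1) * limitDensity (D + 1) (j + 1)
            ≤ (D + 1) * (4 / ((D + 1) * (D + 2) * (D + 3) * (D + 4))) := by gcongr
          _ = 4 / ((D + 2) * (D + 3) * (D + 4)) := by field_simp
          _ ≤ 4 / ((D + 1) * (D + 1) * (D + 1)) := by gcongr <;> norm_num
          _ = _ := by ring
      calc _ ≤ ((j : ℝ) + 1) * (j + 2) * (4 / ((D + 1 : ℕ) : ℝ) ^ 3) := by gcongr
        _ ≤ (k : ℝ) * (k + 1) * (4 / ((D + 1 : ℕ) : ℝ) ^ 3) := by gcongr ?_ * ?_ * _; linarith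
        _ = _ := by ring
    have e4' : 0 ≤ ((j : ℝ) + 1) * (j + 2) * (D * limitDensity D (j + 1)) :=
      mul_nonneg (by positivity) (mul_nonneg (by positivity) (nonneg _ _))
    rw [abs_le]
    constructor <;> nlinarith
  have hsum := (Finset.abs_sum_le_sum_abs _ _).trans (Finset.sum_le_sum hterm)
  rw [Finset.sum_sub_distrib, ← h, Finset.sum_const, Finset.card_range, Finset.sum_add_distrib,
    ← Finset.mul_sum, ← harm, Finset.sum_const, Finset.card_range] at hsum
  simp only [nsmul_eq_mul] at hsum
  have hm : k * (k + 1) * moment D k ≤ 20 * harm k ^ 2 := by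
    have h2 := moment_le hD
    have h3 : harm (k + 1) ≤ 2 * harm k := by
      have : 1 / ((k : ℝ) + 1) ≤ 1 := by
        rw [div_le_one (by positivity)]
        linarith [(Nat.cast_nonneg k : (0 : ℝ) ≤ k)]
      rw [harm_succ]
      linarith
    have h4 : 0 ≤ (k + 1) * moment D k := mul_nonneg (by positivity) (moment_nonneg _ _)
    nlinarith
  have hm' : 0 ≤ k * (k + 1) * moment D k := mul_nonneg (by positivity) (moment_nonneg _ _)
  have hh : harm k ≤ harm k ^ 2 := by nlinarith
  have hr : (k : ℝ) * (4 * (k * (k + 1)) / D ^ 3) = 4 * k * (k * (k + 1)) / D ^ 3 := by ring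
  rw [hr] at hsum
  rw [abs_le] at hsum ⊢
  -- 48 = 8 + 20 from the summands, plus 20 from the moment on the left of the telescoped identity.
  constructor <;> nlinarith [hsum.1, hsum.2]

theorem mass_le (D k : ℕ) : mass D k ≤ 2 := by
  have : ∀ D : ℕ, mass D k ≤ 2 - 2 / ((D : ℝ) + 1) := by
    intro D
    induction D with
    | zero => simp [mass]
    | succ D ih =>
      rw [mass, Finset.sum_range_succ, ← mass]
      have h : limitDensity (D + 1) k ≤ 2 / ((D + 1) * (D + 2)) := by
        refine (le_size D k).trans ?_
        rw [div_le_div_iff₀ (by positivity) (by positivity)]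
        have : (0 : ℝ) ≤ (D + 1) * (D + 2) * (2 * D + k) := by positivity
        nlinarith
      have e : 2 / (((D : ℝ) + 1) * (D + 2)) = 2 / (D + 1) - 2 / (D + 1 + 1) := by
        field_simp; ring
      push_cast
      linarith
  have h := this D
  have : 0 ≤ 2 / ((D : ℝ) + 1) := by positivity
  linarith

end limitDensity

/-! ### One step of the process at the level of graphs -/

namespace LoopGraph

variable {n : ℕ}

theorem le_of_mem_edges {G : LoopGraph n} {a b : ℕ} (h : s(a, b) ∈ G.edges) :
    (1 ≤ a ∧ a ≤ n) ∧ 1 ≤ b ∧ b ≤ n :=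
  ⟨Finset.mem_Icc.1 (G.mem_vertices _ h a (by simp)),
    Finset.mem_Icc.1 (G.mem_vertices _ h b (by simp))⟩

theorem mem_addEdge {G : LoopGraph n} {i : Finset.Icc 1 (n + 1)} {e : Sym2 ℕ} :
    e ∈ (G.addEdge i).edges ↔ e = s(n + 1, (i : ℕ)) ∨ e ∈ G.edges :=
  Finset.mem_insert

theorem new_notMem (G : LoopGraph n) (i : ℕ) : s(n + 1, i) ∉ G.edges := fun h => by
  have := (le_of_mem_edges h).1.2
  omega

/-- The sum of the degrees of the neighbours of `t` that differ from `t`. -/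
def nbrDegree (G : LoopGraph n) (t : ℕ) : ℕ :=
  ∑ i ∈ (Finset.Icc 1 n).filter (fun i => i ≠ t ∧ s(i, t) ∈ G.edges), G.degree i

theorem degree_addEdge {G : LoopGraph n} {i : Finset.Icc 1 (n + 1)} {t : ℕ} (ht : t ≤ n) :
    (G.addEdge i).degree t = G.degree t + if (i : ℕ) = t then 1 else 0 := by
  have h1 : (s(t, t) ∈ (G.addEdge i).edges) ↔ s(t, t) ∈ G.edges := by
    rw [mem_addEdge, or_iff_right]
    intro h
    simp only [Sym2.eq_iff] at h
    omega
  have h2 : ((G.addEdge i).edges.filter (fun e => t ∈ e)).card =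
      (G.edges.filter (fun e => t ∈ e)).card + if (i : ℕ) = t then 1 else 0 := by
    rw [addEdge, Finset.filter_insert]
    have : t ∈ s(n + 1, (i : ℕ)) ↔ (i : ℕ) = t := by
      rw [Sym2.mem_iff]; omega
    simp only [this]
    split_ifs
    · rw [Finset.card_insert_of_notMem]
      intro h
      exact new_notMem G i (Finset.mem_filter.1 h).1
    · rfl
  rw [degree, degree, h2]
  simp only [h1]
  omega

theorem degree_addEdge_new {G : LoopGraph n} {i : Finset.Icc 1 (n + 1)} :
    (G.addEdge i).degree (n + 1) = if (i : ℕ) = n + 1 then 2 else 1 := by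
  have h1 : (s(n + 1, n + 1) ∈ (G.addEdge i).edges) ↔ (i : ℕ) = n + 1 := by
    rw [mem_addEdge, or_iff_left (new_notMem G _), Sym2.eq_iff]
    omega
  have h2 : (G.addEdge i).edges.filter (fun e => n + 1 ∈ e) = {s(n + 1, (i : ℕ))} := by
    ext e
    rw [Finset.mem_filter, mem_addEdge, Finset.mem_singleton]
    constructor
    · rintro ⟨h | h, h'⟩
      · exact h
      · have := Finset.mem_Icc.1 (G.mem_vertices _ h _ h')
        omega
    · rintro rfl
      simp
  rw [degree, h2, Finset.card_singleton]
  simp only [h1]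
  split_ifs <;> rfl

theorem adj_addEdge_iff {G : LoopGraph n} {i : Finset.Icc 1 (n + 1)} {a t : ℕ} (ha : a ≤ n)
    (ht : t ≤ n) : s(a, t) ∈ (G.addEdge i).edges ↔ s(a, t) ∈ G.edges := by
  rw [mem_addEdge, or_iff_right]
  intro h
  simp only [Sym2.eq_iff] at h
  omega

theorem adj_new_iff {G : LoopGraph n} {i : Finset.Icc 1 (n + 1)} {a : ℕ} :
    s(a, n + 1) ∈ (G.addEdge i).edges ↔ a = i := by
  rw [mem_addEdge, or_iff_left]
  · rw [Sym2.eq_iff]; omega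
  · rw [Sym2.eq_swap]; exact new_notMem G a

/-- An edge attached to t itself creates a new neighbour whose only edge contains t, so it does not
count; an edge attached to a neighbour of t counts once. -/
theorem secondDegree_addEdge {G : LoopGraph n} {i : Finset.Icc 1 (n + 1)} {t : ℕ} (ht : t ≤ n) :
    (G.addEdge i).secondDegree t =
      G.secondDegree t + if (i : ℕ) ≠ t ∧ s((i : ℕ), t) ∈ G.edges then 1 else 0 := by
  classical
  have hold : ∀ e ∈ G.edges,
      (∃ a b : ℕ, e = s(a, b) ∧ a ≠ t ∧ b ≠ t ∧ s(a, t) ∈ (G.addEdge i).edges) ↔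
        ∃ a b : ℕ, e = s(a, b) ∧ a ≠ t ∧ b ≠ t ∧ s(a, t) ∈ G.edges := by
    intro e he
    refine exists_congr fun a => exists_congr fun b => and_congr_right fun hab => ?_
    subst hab
    rw [adj_addEdge_iff (le_of_mem_edges he).1.2 ht]
  have hnew : (∃ a b : ℕ, s(n + 1, (i : ℕ)) = s(a, b) ∧ a ≠ t ∧ b ≠ t ∧
      s(a, t) ∈ (G.addEdge i).edges) ↔ (i : ℕ) ≠ t ∧ s((i : ℕ), t) ∈ G.edges := by
    constructor
    · rintro ⟨a, b, h, ha, hb, h'⟩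
      rw [mem_addEdge] at h'
      rcases h' with h' | h'
      · exfalso
        simp only [Sym2.eq_iff] at h h'
        omega
      · have := (le_of_mem_edges h').1.2
        simp only [Sym2.eq_iff] at h
        have : a = i := by omega
        subst this
        exact ⟨ha, h'⟩
    · rintro ⟨h1, h2⟩
      exact ⟨i, n + 1, Sym2.eq_swap, h1, by omega, mem_addEdge.2 (Or.inr h2)⟩
  rw [secondDegree, secondDegree]
  have : (G.addEdge i).edges = insert s(n + 1, (i : ℕ)) G.edges := rfl
  rw [this, Finset.filter_insert, ← this, Finset.filter_congr hold]
  simp only [hnew]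
  split_ifs
  · rw [Finset.card_insert_of_notMem]
    intro h
    exact new_notMem G i (Finset.mem_filter.1 h).1
  · rfl

/-- The only neighbour of the newborn is i, so the edges counted are the old edges at i; the
correction appears because the degree counts a loop twice. -/
theorem secondDegree_addEdge_new_of_le {G : LoopGraph n} {i : Finset.Icc 1 (n + 1)}
    (hi : (i : ℕ) ≤ n) :
    (G.addEdge i).secondDegree (n + 1) + (if s((i : ℕ), (i : ℕ)) ∈ G.edges then 1 else 0) =
      G.degree i := by
  classical
  rw [degree, secondDegree]
  congr 2
  ext e
  rw [Finset.mem_filter, Finset.mem_filter, mem_addEdge]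
  constructor
  · rintro ⟨h, a, b, rfl, ha, hb, h'⟩
    rw [adj_new_iff] at h'
    subst h'
    refine ⟨h.resolve_left fun h => ?_, by simp⟩
    simp only [Sym2.eq_iff] at h
    omega
  · rintro ⟨h, h'⟩
    obtain ⟨b, rfl⟩ := Sym2.mem_iff_exists.1 h'
    have := (le_of_mem_edges h).2.2
    exact ⟨Or.inr h, i, b, rfl, by omega, by omega, adj_new_iff.2 rfl⟩

theorem secondDegree_addEdge_new_loop {G : LoopGraph n} {i : Finset.Icc 1 (n + 1)}
    (hi : (i : ℕ) = n + 1) : (G.addEdge i).secondDegree (n + 1) = 0 := by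
  classical
  rw [secondDegree, Finset.card_eq_zero, Finset.filter_eq_empty_iff]
  rintro e - ⟨a, b, rfl, ha, hb, h'⟩
  rw [adj_new_iff] at h'
  omega

/-- The increment is the sum of those of the degree and of the second degree, whence the
conservation of κ. -/
theorem nbrDegree_addEdge {G : LoopGraph n} {i : Finset.Icc 1 (n + 1)} {t : ℕ} (ht : t ≤ n) :
    (G.addEdge i).nbrDegree t = G.nbrDegree t +
      ((if (i : ℕ) = t then 1 else 0) + if (i : ℕ) ≠ t ∧ s((i : ℕ), t) ∈ G.edges then 1 else 0) := by
  have hnew : s(n + 1, t) ∈ (G.addEdge i).edges ↔ (i : ℕ) = t := by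
    rw [mem_addEdge, or_iff_left (new_notMem G t), Sym2.eq_iff]
    omega
  rw [nbrDegree, nbrDegree, Finset.sum_filter, Finset.sum_filter, Finset.sum_Icc_succ_top (by omega)]
  have h1 : ∀ j ∈ Finset.Icc 1 n,
      (if j ≠ t ∧ s(j, t) ∈ (G.addEdge i).edges then (G.addEdge i).degree j else 0) =
      (if j ≠ t ∧ s(j, t) ∈ G.edges then G.degree j else 0) +
        if j = i then (if (i : ℕ) ≠ t ∧ s((i : ℕ), t) ∈ G.edges then 1 else 0) else 0 := by
    intro j hj
    have hj := (Finset.mem_Icc.1 hj).2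
    simp only [adj_addEdge_iff hj ht, degree_addEdge hj]
    by_cases hji : j = i
    · subst hji
      simp only [if_true]
      split_ifs <;> rfl
    · rw [if_neg hji, if_neg (Ne.symm hji)]
      rfl
  rw [Finset.sum_congr rfl h1, Finset.sum_add_distrib, Finset.sum_ite_eq', degree_addEdge_new]
  simp only [hnew]
  have hi := Finset.mem_Icc.1 i.2
  by_cases hin : (i : ℕ) = n + 1
  · have h3 : ¬ ((i : ℕ) ≠ t ∧ s((i : ℕ), t) ∈ G.edges) := fun h => by
      rw [hin] at h; exact new_notMem G t h.2
    have h4 : (i : ℕ) ∉ Finset.Icc 1 n := by rw [Finset.mem_Icc]; omega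
    rw [if_neg h3, if_neg h4, if_neg (by omega : ¬ (i : ℕ) = t), if_neg (by omega)]
    rfl
  · have h4 : (i : ℕ) ∈ Finset.Icc 1 n := by rw [Finset.mem_Icc]; omega
    rw [if_pos h4, if_neg hin]
    have : (n + 1 ≠ t ∧ (i : ℕ) = t) ↔ (i : ℕ) = t := by omega
    simp only [this]
    omega

theorem nbrDegree_addEdge_new_of_le {G : LoopGraph n} {i : Finset.Icc 1 (n + 1)}
    (hi : (i : ℕ) ≤ n) : (G.addEdge i).nbrDegree (n + 1) = G.degree i + 1 := by
  have : (Finset.Icc 1 (n + 1)).filter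
      (fun j => j ≠ n + 1 ∧ s(j, n + 1) ∈ (G.addEdge i).edges) = {(i : ℕ)} := by
    ext j
    have := Finset.mem_Icc.1 i.2
    rw [Finset.mem_filter, adj_new_iff, Finset.mem_singleton, Finset.mem_Icc]
    omega
  rw [nbrDegree, this, Finset.sum_singleton, degree_addEdge hi, if_pos rfl]

theorem nbrDegree_addEdge_new_loop {G : LoopGraph n} {i : Finset.Icc 1 (n + 1)}
    (hi : (i : ℕ) = n + 1) : (G.addEdge i).nbrDegree (n + 1) = 0 := by
  rw [nbrDegree]
  refine Finset.sum_eq_zero fun j hj => ?_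
  rw [Finset.mem_filter, adj_new_iff] at hj
  omega

theorem loop_addEdge_iff {G : LoopGraph n} {i : Finset.Icc 1 (n + 1)} {t : ℕ} (ht : t ≤ n) :
    s(t, t) ∈ (G.addEdge i).edges ↔ s(t, t) ∈ G.edges := adj_addEdge_iff ht ht

theorem loop_new_iff {G : LoopGraph n} {i : Finset.Icc 1 (n + 1)} :
    s(n + 1, n + 1) ∈ (G.addEdge i).edges ↔ (i : ℕ) = n + 1 := by
  rw [adj_new_iff]; omega

theorem degree_le (G : LoopGraph n) (t : ℕ) :
    G.degree t ≤ n + if s(t, t) ∈ G.edges then 1 else 0 := by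
  have := Finset.card_filter_le G.edges (fun e => t ∈ e)
  rw [G.card_edges] at this
  rw [degree]
  omega

/-- The possible values of the degree, the second degree and the sum of the degrees of the
neighbours of a vertex in a graph on `n` vertices produced by the process. The three cases are those
of a vertex joined to a vertex without a loop, to another vertex with a loop, and to itself. -/
def Admissible (n d k K : ℕ) : Prop :=
  1 ≤ d ∧ d + K ≤ 2 * n ∧
    ((K = d + k ∧ d + K < 2 * n ∧ d ≤ n) ∨ (K = d + k + 1 ∧ d ≤ n) ∨
      (K + 2 = d + k ∧ 2 ≤ d ∧ d ≤ n + 1))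

/-- A property shared by all graphs produced by the process. -/
def Regular (G : LoopGraph n) : Prop :=
  ∀ t ∈ Finset.Icc 1 n, Admissible n (G.degree t) (G.secondDegree t) (G.nbrDegree t) ∧
    (s(t, t) ∈ G.edges ↔ G.nbrDegree t + 2 = G.degree t + G.secondDegree t)

theorem regular_empty : empty.Regular := by
  intro t ht
  simp at ht

theorem Regular.addEdge {G : LoopGraph n} (h : G.Regular) (i : Finset.Icc 1 (n + 1)) :
    (G.addEdge i).Regular := by
  intro t ht
  rw [Finset.mem_Icc] at ht
  rcases Nat.lt_or_ge n t with htn | htn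
  · obtain rfl : t = n + 1 := by omega
    rw [degree_addEdge_new, loop_new_iff, Admissible]
    have hi := Finset.mem_Icc.1 i.2
    rcases Nat.lt_or_ge n i with hin | hin
    · have hin : (i : ℕ) = n + 1 := by omega
      rw [secondDegree_addEdge_new_loop hin, nbrDegree_addEdge_new_loop hin, if_pos hin]
      omega
    · have h1 := secondDegree_addEdge_new_of_le (G := G) hin
      have h2 := G.degree_le i
      rw [nbrDegree_addEdge_new_of_le hin, if_neg (by omega)]
      split_ifs at h1 h2 <;> omega
  · have h0 := h t (Finset.mem_Icc.2 ⟨ht.1, htn⟩)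
    rw [loop_addEdge_iff htn, h0.2]
    have h1 := h0.1
    rw [Admissible] at h1 ⊢
    rw [degree_addEdge htn, secondDegree_addEdge htn, nbrDegree_addEdge htn]
    by_cases h1 : (i : ℕ) = t
    · simp only [h1, if_true, ne_eq, not_true_eq_false, false_and, if_false]
      omega
    · simp only [h1, if_false]
      split_ifs <;> omega

/-- The attachment probability as a real number. -/
noncomputable def attach (G : LoopGraph n) (s : ℕ) : ℝ := (G.attachProb s).toReal

theorem attach_of_le {G : LoopGraph n} {s : ℕ} (h : s ≤ n) :
    G.attach s = G.degree s / (2 * n + 1) := by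
  rw [attach, attachProb, if_pos h, ENNReal.toReal_div]
  simp only [ENNReal.toReal_natCast]
  push_cast
  rfl

theorem attach_new {G : LoopGraph n} : G.attach (n + 1) = 1 / (2 * n + 1) := by
  rw [attach, attachProb, if_neg (by omega), ENNReal.toReal_div]
  simp only [ENNReal.toReal_natCast, ENNReal.toReal_one]
  push_cast
  rfl

theorem attach_nonneg (G : LoopGraph n) (s : ℕ) : 0 ≤ G.attach s := ENNReal.toReal_nonneg

theorem sum_attach_mul (G : LoopGraph n) (φ : ℕ → ℝ) :
    ∑ i : Finset.Icc 1 (n + 1), G.attach i * φ i =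
      (∑ i ∈ Finset.Icc 1 n, G.degree i * φ i + φ (n + 1)) / (2 * n + 1) := by
  rw [Finset.sum_coe_sort (Finset.Icc 1 (n + 1)) (fun i => G.attach i * φ i),
    Finset.sum_Icc_succ_top (by omega), attach_new, add_div, Finset.sum_div]
  congr 1
  · refine Finset.sum_congr rfl fun i hi => ?_
    rw [attach_of_le (Finset.mem_Icc.1 hi).2]
    ring
  · ring

theorem sum_attach (G : LoopGraph n) : ∑ i : Finset.Icc 1 (n + 1), G.attach i = 1 := by
  have h := G.sum_attach_mul fun _ => 1
  simp only [mul_one] at h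
  rw [h, ← Nat.cast_sum, G.sum_degree]
  push_cast
  exact div_self (by positivity)

/-- One step of the process seen from an old vertex. -/
theorem sum_attach_old (G : LoopGraph n) {t : ℕ} (ht : t ∈ Finset.Icc 1 n) (φ : ℕ → ℕ → ℕ → ℝ) :
    ∑ i : Finset.Icc 1 (n + 1), G.attach i * φ ((G.addEdge i).degree t)
        ((G.addEdge i).secondDegree t) ((G.addEdge i).nbrDegree t) =
      φ (G.degree t) (G.secondDegree t) (G.nbrDegree t) *
          (1 - (G.degree t + G.nbrDegree t) / (2 * n + 1)) +
        φ (G.degree t + 1) (G.secondDegree t) (G.nbrDegree t + 1) * (G.degree t / (2 * n + 1)) +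
        φ (G.degree t) (G.secondDegree t + 1) (G.nbrDegree t + 1) *
          (G.nbrDegree t / (2 * n + 1)) := by
  set d := G.degree t with hd
  set k := G.secondDegree t with hk
  set K := G.nbrDegree t with hK
  have htn := (Finset.mem_Icc.1 ht).2
  have h1 : ∀ i : Finset.Icc 1 (n + 1), G.attach i * φ ((G.addEdge i).degree t)
        ((G.addEdge i).secondDegree t) ((G.addEdge i).nbrDegree t) =
      G.attach i * φ d k K + G.attach i * (if (i : ℕ) = t then φ (d + 1) k (K + 1) - φ d k K else 0) +
        G.attach i * (if (i : ℕ) ≠ t ∧ s((i : ℕ), t) ∈ G.edges then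
          φ d (k + 1) (K + 1) - φ d k K else 0) := by
    intro i
    rw [degree_addEdge htn, secondDegree_addEdge htn, nbrDegree_addEdge htn, ← hd, ← hk, ← hK]
    by_cases h1 : (i : ℕ) = t
    · simp only [h1, if_true, ne_eq, not_true_eq_false, false_and, if_false, add_zero]
      ring
    · simp only [h1, if_false, add_zero, zero_add]
      split_ifs
      · ring
      · simp only [add_zero, mul_zero]
  have hn : (2 * (n : ℝ) + 1) ≠ 0 := by positivity
  have hKs : (K : ℝ) = ∑ i ∈ Finset.Icc 1 n,
      if i ≠ t ∧ s(i, t) ∈ G.edges then (G.degree i : ℝ) else 0 := by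
    rw [hK, nbrDegree, Finset.sum_filter]
    push_cast
    rfl
  rw [Finset.sum_congr rfl fun i _ => h1 i, Finset.sum_add_distrib, Finset.sum_add_distrib,
    ← Finset.sum_mul, sum_attach,
    sum_attach_mul G (fun i => if i = t then φ (d + 1) k (K + 1) - φ d k K else 0),
    sum_attach_mul G (fun i => if i ≠ t ∧ s(i, t) ∈ G.edges then
          φ d (k + 1) (K + 1) - φ d k K else 0)]
  simp only [mul_ite, mul_zero]
  rw [Finset.sum_ite_eq', if_pos ht, ← hd, if_neg (by omega : ¬ n + 1 = t),
    if_neg (fun h => new_notMem G t h.2)]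
  have h2 : ∑ i ∈ Finset.Icc 1 n, (if i ≠ t ∧ s(i, t) ∈ G.edges then
      (G.degree i : ℝ) * (φ d (k + 1) (K + 1) - φ d k K) else 0) =
      K * (φ d (k + 1) (K + 1) - φ d k K) := by
    rw [hKs, Finset.sum_mul]
    refine Finset.sum_congr rfl fun i _ => ?_
    split_ifs <;> simp
  rw [h2]
  field_simp
  ring

instance : Finite (LoopGraph n) :=
  Finite.of_injective (β := (Finset.sym2 (Finset.Icc 1 n)).powerset)
    (fun G => ⟨G.edges, Finset.mem_powerset.2 fun e he =>
      Finset.mem_sym2_iff.2 (G.mem_vertices e he)⟩)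
    fun _ _ h => LoopGraph.ext (congrArg Subtype.val h)

end LoopGraph

/-! ### Expectations along the process -/

open LoopGraph

/-- The expectation of a function of `G_1^n`, by recursion along the process. -/
noncomputable def expect : (n : ℕ) → (LoopGraph n → ℝ) → ℝ
  | 0, φ => φ LoopGraph.empty
  | n + 1, φ => expect n fun G => ∑ i : Finset.Icc 1 (n + 1), G.attach i * φ (G.addEdge i)

theorem tsum_prefAttach (n : ℕ) (φ : LoopGraph n → ℝ) :
    ∑' G : LoopGraph n, (prefAttach n G).toReal * φ G = expect n φ := by
  classical
  induction n with
  | zero =>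
    rw [tsum_eq_single LoopGraph.empty]
    · simp [prefAttach, expect]
    · intro G hG
      simp [prefAttach, PMF.pure_apply, hG]
  | succ n ih =>
    have := Fintype.ofFinite (LoopGraph n)
    have := Fintype.ofFinite (LoopGraph (n + 1))
    rw [expect, ← ih, tsum_fintype, tsum_fintype]
    have h : ∀ G' : LoopGraph (n + 1), (prefAttach (n + 1) G').toReal =
        ∑ G : LoopGraph n, (prefAttach n G).toReal *
          ∑ i : Finset.Icc 1 (n + 1), if G' = G.addEdge i then G.attach i else 0 := by
      intro G'
      rw [prefAttach, PMF.bind_apply, tsum_fintype, ENNReal.toReal_sum]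
      · refine Finset.sum_congr rfl fun G _ => ?_
        rw [ENNReal.toReal_mul, PMF.map_apply, tsum_fintype, ENNReal.toReal_sum]
        · congr 1
          refine Finset.sum_congr rfl fun i _ => ?_
          split_ifs
          · rfl
          · rfl
        · intro i _
          split_ifs
          · exact PMF.apply_ne_top _ _
          · exact ENNReal.zero_ne_top
      · intro G _
        exact ENNReal.mul_ne_top (PMF.apply_ne_top _ _) (PMF.apply_ne_top _ _)
    simp_rw [h, Finset.sum_mul, Finset.mul_sum, Finset.sum_mul]
    rw [Finset.sum_comm]
    refine Finset.sum_congr rfl fun G _ => ?_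
    rw [Finset.sum_comm]
    refine Finset.sum_congr rfl fun i _ => ?_
    rw [Finset.sum_eq_single (G.addEdge i)]
    · rw [if_pos rfl, mul_assoc]
    · intro G' _ hG'
      rw [if_neg hG', mul_zero, zero_mul]
    · simp

namespace expect

theorem add (n : ℕ) (φ ψ : LoopGraph n → ℝ) :
    expect n (fun G => φ G + ψ G) = expect n φ + expect n ψ := by
  induction n with
  | zero => rfl
  | succ n ih =>
    simp only [expect, mul_add, Finset.sum_add_distrib]
    exact ih _ _

theorem mul_right (n : ℕ) (φ : LoopGraph n → ℝ) (c : ℝ) :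
    expect n (fun G => φ G * c) = expect n φ * c := by
  induction n with
  | zero => rfl
  | succ n ih =>
    simp only [expect, ← mul_assoc, ← Finset.sum_mul]
    exact ih _

theorem zero (n : ℕ) : expect n (fun _ => 0) = 0 := by
  simpa using mul_right n (fun _ => 0) 0

theorem sum {ι : Type*} (n : ℕ) (s : Finset ι) (φ : ι → LoopGraph n → ℝ) :
    expect n (fun G => ∑ j ∈ s, φ j G) = ∑ j ∈ s, expect n (φ j) := by
  classical
  induction s using Finset.induction_on with
  | empty => simp [zero]
  | insert a s ha ih =>
    simp only [Finset.sum_insert ha]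
    rw [add, ih]

/-- The comparison is needed only on graphs satisfying the invariant, since `Regular` is preserved
by every step. -/
theorem mono (n : ℕ) {φ ψ : LoopGraph n → ℝ} (h : ∀ G, G.Regular → φ G ≤ ψ G) :
    expect n φ ≤ expect n ψ := by
  induction n with
  | zero => exact h _ regular_empty
  | succ n ih =>
    exact ih fun G hG => Finset.sum_le_sum fun i _ =>
      mul_le_mul_of_nonneg_left (h _ (hG.addEdge i)) (G.attach_nonneg i)

theorem congr (n : ℕ) {φ ψ : LoopGraph n → ℝ} (h : ∀ G, G.Regular → φ G = ψ G) :
    expect n φ = expect n ψ :=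
  le_antisymm (mono n fun G hG => (h G hG).le) (mono n fun G hG => (h G hG).ge)

theorem const (n : ℕ) (c : ℝ) : expect n (fun _ => c) = c := by
  induction n with
  | zero => rfl
  | succ n ih =>
    simp only [expect, ← Finset.sum_mul, sum_attach, one_mul]
    exact ih

end expect

/-- The expected sum over the vertices of `G_1^n` of a function of the degree, the second degree and
the sum of the degrees of the neighbours. -/
noncomputable def vertexMean (n : ℕ) (φ : ℕ → ℕ → ℕ → ℝ) : ℝ :=
  expect n fun G => ∑ t ∈ Finset.Icc 1 n, φ (G.degree t) (G.secondDegree t) (G.nbrDegree t)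

namespace vertexMean

theorem add (n : ℕ) (φ ψ : ℕ → ℕ → ℕ → ℝ) :
    vertexMean n (fun d k K => φ d k K + ψ d k K) = vertexMean n φ + vertexMean n ψ := by
  simp only [vertexMean, Finset.sum_add_distrib]
  exact expect.add n _ _

theorem mul_right (n : ℕ) (φ : ℕ → ℕ → ℕ → ℝ) (c : ℝ) :
    vertexMean n (fun d k K => φ d k K * c) = vertexMean n φ * c := by
  simp only [vertexMean, ← Finset.sum_mul]
  exact expect.mul_right n _ _

theorem mono (n : ℕ) {φ ψ : ℕ → ℕ → ℕ → ℝ} (h : ∀ d k K, Admissible n d k K → φ d k K ≤ ψ d k K) :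
    vertexMean n φ ≤ vertexMean n ψ :=
  expect.mono n fun _ hG => Finset.sum_le_sum fun t ht => h _ _ _ (hG t ht).1

theorem congr (n : ℕ) {φ ψ : ℕ → ℕ → ℕ → ℝ} (h : ∀ d k K, Admissible n d k K → φ d k K = ψ d k K) :
    vertexMean n φ = vertexMean n ψ :=
  le_antisymm (mono n fun d k K hG => (h d k K hG).le) (mono n fun d k K hG => (h d k K hG).ge)

theorem zero (n : ℕ) : vertexMean n (fun _ _ _ => 0) = 0 := by
  simpa using mul_right n (fun _ _ _ => 0) 0

theorem one (n : ℕ) : vertexMean n (fun _ _ _ => 1) = n := by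
  simp [vertexMean, expect.const]

theorem nonneg (n : ℕ) {φ : ℕ → ℕ → ℕ → ℝ} (h : ∀ d k K, 0 ≤ φ d k K) : 0 ≤ vertexMean n φ := by
  rw [← zero n]
  exact mono n fun d k K _ => h d k K

theorem eq_zero (n : ℕ) {φ : ℕ → ℕ → ℕ → ℝ} (h : ∀ d k K, Admissible n d k K → φ d k K = 0) :
    vertexMean n φ = 0 := (congr n h).trans (zero n)

theorem sum {ι : Type*} (n : ℕ) (s : Finset ι) (φ : ι → ℕ → ℕ → ℕ → ℝ) :
    vertexMean n (fun d k K => ∑ j ∈ s, φ j d k K) = ∑ j ∈ s, vertexMean n (φ j) := by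
  simp only [vertexMean]
  rw [← expect.sum]
  congr 1
  funext G
  rw [Finset.sum_comm]

theorem degree (n : ℕ) : vertexMean n (fun d _ _ => d) = 2 * n := by
  have : ∀ G : LoopGraph n, ∑ t ∈ Finset.Icc 1 n, (G.degree t : ℝ) = 2 * n := fun G => by
    rw [← Nat.cast_sum, G.sum_degree]
    push_cast
    rfl
  simp only [vertexMean, this, expect.const]

/-- The last summand is the newborn vertex. A loop at its host is read off from K + 2 = d + k, so
the three statistics suffice to close the recursion. -/
theorem succ (n : ℕ) (φ : ℕ → ℕ → ℕ → ℝ) :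
    vertexMean (n + 1) φ =
      vertexMean n (fun d k K => φ d k K * (1 - (d + K) / (2 * n + 1)) +
        φ (d + 1) k (K + 1) * (d / (2 * n + 1)) + φ d (k + 1) (K + 1) * (K / (2 * n + 1))) +
      (vertexMean n (fun d k K => d * φ 1 (if K + 2 = d + k then d - 1 else d) (d + 1)) +
        φ 2 0 0) / (2 * n + 1) := by
  rw [add_div, ← expect.const n (φ 2 0 0 / (2 * n + 1)), div_eq_mul_inv (vertexMean n _),
    ← mul_right]
  simp only [vertexMean, expect]
  rw [← expect.add, ← expect.add]
  refine expect.congr n fun G hG => ?_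
  simp only [Finset.sum_Icc_succ_top (Nat.le_add_left 1 n), mul_add, Finset.sum_add_distrib,
    Finset.mul_sum]
  rw [Finset.sum_comm]
  congr 1
  · rw [← Finset.sum_add_distrib, ← Finset.sum_add_distrib]
    exact Finset.sum_congr rfl fun t ht => sum_attach_old G ht φ
  · let ψ : ℕ → ℝ := fun j => if j ≤ n then φ 1 (if G.nbrDegree j + 2 = G.degree j +
      G.secondDegree j then G.degree j - 1 else G.degree j) (G.degree j + 1) else φ 2 0 0
    have h : ∀ i : Finset.Icc 1 (n + 1), G.attach i * φ ((G.addEdge i).degree (n + 1))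
        ((G.addEdge i).secondDegree (n + 1)) ((G.addEdge i).nbrDegree (n + 1)) =
        G.attach i * ψ i := by
      intro i
      have hi := Finset.mem_Icc.1 i.2
      rw [degree_addEdge_new]
      simp only [ψ]
      rcases Nat.lt_or_ge n i with hin | hin
      · have hin : (i : ℕ) = n + 1 := by omega
        rw [secondDegree_addEdge_new_loop hin, nbrDegree_addEdge_new_loop hin, if_pos hin,
          if_neg (by omega)]
      · have h1 := secondDegree_addEdge_new_of_le (G := G) hin
        have h2 := (hG i (Finset.mem_Icc.2 ⟨hi.1, hin⟩)).2
        rw [nbrDegree_addEdge_new_of_le hin, if_neg (by omega), if_pos hin]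
        congr 2
        rw [← if_congr h2 rfl rfl]
        split_ifs at h1 ⊢ <;> omega
    rw [Finset.sum_congr rfl fun i _ => h i, sum_attach_mul G ψ, add_div, Finset.sum_div]
    simp only [ψ]
    rw [if_neg (by omega)]
    congr 1
    refine Finset.sum_congr rfl fun t ht => ?_
    rw [if_pos (Finset.mem_Icc.1 ht).2, div_eq_mul_inv]

end vertexMean

/-! ### Recursions for the counts, by degree and by class κ -/

/-- The expected number of vertices without a loop that have degree `d`. -/
noncomputable def plainCount (n d : ℕ) : ℝ :=
  vertexMean n fun d' k' K' => if d' = d ∧ K' + 2 ≠ d' + k' then 1 else 0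

/-- The expected number of vertices with a loop that have degree `d`. -/
noncomputable def loopCount (n d : ℕ) : ℝ :=
  vertexMean n fun d' k' K' => if d' = d ∧ K' + 2 = d' + k' then 1 else 0

/-- The expected number of vertices of degree `d` and second degree `k` for which the degrees of the
neighbours add up to `d + k + κ`. -/
noncomputable def jointCount (n : ℕ) (κ : ℤ) (d k : ℕ) : ℝ :=
  vertexMean n fun d' k' K' => if d' = d ∧ k' = k ∧ (K' : ℤ) = d + k + κ then 1 else 0

theorem plainCount_succ (n d : ℕ) :
    plainCount (n + 1) (d + 1) = plainCount n (d + 1) * (1 - (d + 1) / (2 * n + 1)) +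
      plainCount n d * (d / (2 * n + 1)) + if d = 0 then 2 * (n : ℝ) / (2 * n + 1) else 0 := by
  rw [plainCount, vertexMean.succ, plainCount, plainCount, ← vertexMean.mul_right,
    ← vertexMean.mul_right, ← vertexMean.add]
  congr 1
  · refine vertexMean.congr n fun d' k' K' _ => ?_
    have h1 : (d' + 1 = d + 1 ∧ K' + 1 + 2 ≠ d' + 1 + k') ↔ (d' = d ∧ K' + 2 ≠ d' + k') := by omega
    have h2 : (d' = d + 1 ∧ K' + 1 + 2 ≠ d' + (k' + 1)) ↔ (d' = d + 1 ∧ K' + 2 ≠ d' + k') := by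
      omega
    simp only [h1, h2]
    by_cases h3 : d' = d + 1 ∧ K' + 2 ≠ d' + k'
    · obtain ⟨rfl, h3⟩ := h3
      simp [h3]
      ring
    · rw [if_neg h3]
      by_cases h4 : d' = d ∧ K' + 2 ≠ d' + k'
      · rw [if_pos h4, h4.1]; ring
      · rw [if_neg h4]; ring
  · rw [if_neg (by simp), add_zero]
    split_ifs with hd
    · subst hd
      -- Any old host gives a loopless newborn of degree one, so the source is the total degree 2n.
      rw [← vertexMean.degree n]
      congr 1
      refine vertexMean.congr n fun d' k' K' h => ?_
      rw [Admissible] at h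
      rw [if_pos, mul_one]
      split_ifs <;> omega
    · rw [div_eq_zero_iff]
      left
      refine vertexMean.eq_zero n fun d' k' K' _ => ?_
      rw [if_neg, mul_zero]
      omega

theorem loopCount_succ (n d : ℕ) :
    loopCount (n + 1) (d + 1) = loopCount n (d + 1) * (1 - (d + 1) / (2 * n + 1)) +
      loopCount n d * (d / (2 * n + 1)) + if d = 1 then 1 / (2 * (n : ℝ) + 1) else 0 := by
  rw [loopCount, vertexMean.succ, loopCount, loopCount, ← vertexMean.mul_right,
    ← vertexMean.mul_right, ← vertexMean.add]
  congr 1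
  · refine vertexMean.congr n fun d' k' K' _ => ?_
    have h1 : (d' + 1 = d + 1 ∧ K' + 1 + 2 = d' + 1 + k') ↔ (d' = d ∧ K' + 2 = d' + k') := by omega
    have h2 : (d' = d + 1 ∧ K' + 1 + 2 = d' + (k' + 1)) ↔ (d' = d + 1 ∧ K' + 2 = d' + k') := by
      omega
    simp only [h1, h2]
    by_cases h3 : d' = d + 1 ∧ K' + 2 = d' + k'
    · obtain ⟨rfl, h3⟩ := h3
      simp [h3]
      ring
    · rw [if_neg h3]
      by_cases h4 : d' = d ∧ K' + 2 = d' + k'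
      · rw [if_pos h4, h4.1]; ring
      · rw [if_neg h4]; ring
  · rw [vertexMean.eq_zero n, zero_add]
    · rw [if_congr (by omega : (2 = d + 1 ∧ 0 + 2 = 2 + 0) ↔ d = 1) rfl rfl]
      split_ifs
      · rfl
      · rw [zero_div]
    · intro d' k' K' h
      rw [if_neg, mul_zero]
      split_ifs <;> omega

/-- The expected number of edge ends that would produce a new vertex of degree `d`, second degree
`k` and neighbouring degrees adding up to `d + k + κ`. -/
noncomputable def jointSource (n : ℕ) (κ : ℤ) (d k : ℕ) : ℝ :=
  vertexMean n (fun d' k' K' => d' * if 1 = d ∧ (if K' + 2 = d' + k' then d' - 1 else d') = k ∧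
    ((d' + 1 : ℕ) : ℤ) = d + k + κ then 1 else 0) +
  if 2 = d ∧ 0 = k ∧ ((0 : ℕ) : ℤ) = d + k + κ then 1 else 0

theorem jointCount_succ (n : ℕ) (κ : ℤ) (d k : ℕ) :
    jointCount (n + 1) κ (d + 1) k =
      jointCount n κ (d + 1) k * (1 - (2 * (d + 1) + k + κ) / (2 * n + 1)) +
      jointCount n κ d k * (d / (2 * n + 1)) +
      (if k = 0 then 0 else jointCount n κ (d + 1) (k - 1) * ((d + k + κ) / (2 * n + 1))) +
      jointSource n κ (d + 1) k / (2 * n + 1) := by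
  have hprev : (if k = 0 then 0 else jointCount n κ (d + 1) (k - 1) * ((d + k + κ) / (2 * n + 1))) =
      vertexMean n fun d' k' K' => (if d' = d + 1 ∧ k' + 1 = k ∧ (K' : ℤ) = d + k + κ
        then (1 : ℝ) else 0) * ((d + k + κ) / (2 * n + 1)) := by
    split_ifs with hk
    · subst hk
      rw [vertexMean.eq_zero]
      intro d' k' K' _
      rw [if_neg (by omega), zero_mul]
    · rw [vertexMean.mul_right, jointCount]
      congr 1
      refine vertexMean.congr n fun d' k' K' _ => if_congr ?_ rfl rfl
      push_cast
      omega
  rw [hprev, jointCount, vertexMean.succ, jointCount, jointCount, ← vertexMean.mul_right,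
    ← vertexMean.mul_right, ← vertexMean.add, ← vertexMean.add]
  congr 1
  refine vertexMean.congr n fun d' k' K' _ => ?_
  have h1 : (d' + 1 = d + 1 ∧ k' = k ∧ ((K' + 1 : ℕ) : ℤ) = (d + 1 : ℕ) + k + κ) ↔
      (d' = d ∧ k' = k ∧ (K' : ℤ) = d + k + κ) := by omega
  have h2 : (d' = d + 1 ∧ k' + 1 = k ∧ ((K' + 1 : ℕ) : ℤ) = (d + 1 : ℕ) + k + κ) ↔
      (d' = d + 1 ∧ k' + 1 = k ∧ (K' : ℤ) = d + k + κ) := by omega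
  simp only [h1, h2]
  congr 1
  · congr 1
    · split_ifs with h
      · obtain ⟨rfl, rfl, h⟩ := h
        have h' : (K' : ℝ) = (d + 1 : ℕ) + k' + κ := by exact_mod_cast h
        rw [h']
        push_cast
        ring
      · simp
    · split_ifs with h
      · rw [h.1]
      · simp
  · split_ifs with h
    · have h' : (K' : ℝ) = d + k + κ := by exact_mod_cast h.2.2
      rw [h']
    · simp

/-- A newborn of class 0 has a loopless host of degree k. In class 1 the host has degree k + 1, its
loop being counted once in the second degree; class -2 comes only from the new loop. -/
theorem jointSource_zero (n d k : ℕ) :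
    jointSource n 0 (d + 1) k = if d = 0 then k * plainCount n k else 0 := by
  rw [jointSource, if_neg (by omega), add_zero]
  split_ifs with hd
  · subst hd
    rw [plainCount, mul_comm, ← vertexMean.mul_right]
    refine vertexMean.congr n fun d' k' K' h => ?_
    rw [Admissible] at h
    by_cases h1 : d' = k ∧ K' + 2 ≠ d' + k'
    · rw [if_pos h1, if_pos, mul_one, one_mul, h1.1]
      rw [if_neg h1.2]
      omega
    · rw [if_neg h1, if_neg, mul_zero, zero_mul]
      split_ifs <;> omega
  · refine vertexMean.eq_zero n fun d' k' K' _ => ?_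
    rw [if_neg, mul_zero]
    omega

theorem jointSource_one (n d k : ℕ) :
    jointSource n 1 (d + 1) k = if d = 0 then (k + 1) * loopCount n (k + 1) else 0 := by
  rw [jointSource, if_neg (by omega), add_zero]
  split_ifs with hd
  · subst hd
    rw [loopCount, mul_comm, ← vertexMean.mul_right]
    refine vertexMean.congr n fun d' k' K' h => ?_
    rw [Admissible] at h
    by_cases h1 : d' = k + 1 ∧ K' + 2 = d' + k'
    · rw [if_pos h1, if_pos, mul_one, one_mul, h1.1]
      · push_cast; rfl
      · rw [if_pos h1.2]
        omega
    · rw [if_neg h1, if_neg, mul_zero, zero_mul]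
      split_ifs <;> omega
  · refine vertexMean.eq_zero n fun d' k' K' _ => ?_
    rw [if_neg, mul_zero]
    omega

theorem jointSource_neg_two (n d k : ℕ) :
    jointSource n (-2) (d + 1) k = if d = 1 ∧ k = 0 then 1 else 0 := by
  rw [jointSource, vertexMean.eq_zero, zero_add]
  · exact if_congr (by omega) rfl rfl
  · intro d' k' K' h
    rw [Admissible] at h
    rw [if_neg, mul_zero]
    split_ifs <;> omega

theorem loopCount_nonneg (n d : ℕ) : 0 ≤ loopCount n d :=
  vertexMean.nonneg n fun _ _ _ => by split_ifs <;> norm_num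

theorem jointCount_nonneg (n : ℕ) (κ : ℤ) (d k : ℕ) : 0 ≤ jointCount n κ d k :=
  vertexMean.nonneg n fun _ _ _ => by split_ifs <;> norm_num

theorem loopCount_le (n d : ℕ) : loopCount n d ≤ n := by
  rw [← vertexMean.one n]
  exact vertexMean.mono n fun _ _ _ _ => by split_ifs <;> norm_num

theorem jointCount_le (n : ℕ) (κ : ℤ) (d k : ℕ) : jointCount n κ d k ≤ n := by
  rw [← vertexMean.one n]
  exact vertexMean.mono n fun _ _ _ _ => by split_ifs <;> norm_num

theorem plainCount_eq_zero {n d : ℕ} (h : n < d) : plainCount n d = 0 :=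
  vertexMean.eq_zero n fun d' k' K' h' => if_neg (by rw [Admissible] at h'; omega)

theorem loopCount_eq_zero {n d : ℕ} (h : n + 1 < d) : loopCount n d = 0 :=
  vertexMean.eq_zero n fun d' k' K' h' => if_neg (by rw [Admissible] at h'; omega)

theorem loopCount_one (n : ℕ) : loopCount n 1 = 0 :=
  vertexMean.eq_zero n fun d' k' K' h' => if_neg (by rw [Admissible] at h'; omega)

theorem jointCount_zero_left (n : ℕ) (κ : ℤ) (k : ℕ) : jointCount n κ 0 k = 0 :=
  vertexMean.eq_zero n fun d' k' K' h' => if_neg (by rw [Admissible] at h'; omega)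

theorem jointCount_eq_zero {n : ℕ} {κ : ℤ} {d k : ℕ} (h : 2 * (n : ℤ) < 2 * d + k + κ) :
    jointCount n κ d k = 0 :=
  vertexMean.eq_zero n fun d' k' K' h' => if_neg (by rw [Admissible] at h'; omega)

theorem jointCount_eq_zero_of_le {n d k : ℕ} (h : 2 * n ≤ 2 * d + k) :
    jointCount n 0 d k = 0 :=
  vertexMean.eq_zero n fun d' k' K' h' => if_neg (by rw [Admissible] at h'; omega)

theorem jointCount_degree_eq_zero {n : ℕ} {κ : ℤ} {d k : ℕ} (h : 2 * n < d) :
    jointCount n κ d k = 0 :=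
  vertexMean.eq_zero n fun d' k' K' h' => if_neg (by rw [Admissible] at h'; omega)

theorem jointCount_neg_two_one (n k : ℕ) : jointCount n (-2) 1 k = 0 :=
  vertexMean.eq_zero n fun d' k' K' h' => if_neg (by rw [Admissible] at h'; omega)

/-! ### Uniform error bounds by supersolutions -/

/-- The weighted count at d + 1 is updated by an average of itself and of inflow plus source at d,
both at most 2. This makes the source of class 1 bounded. -/
theorem succ_mul_loopCount_le (n d : ℕ) : (d + 1) * loopCount n (d + 1) ≤ 2 := by
  induction n generalizing d with
  | zero =>
    have := loopCount_le 0 (d + 1)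
    have h0 := loopCount_nonneg 0 (d + 1)
    have : loopCount 0 (d + 1) = 0 := by push_cast at this; linarith
    rw [this]; norm_num
  | succ n ih =>
    rcases Nat.eq_zero_or_pos d with rfl | hd
    · rw [zero_add, loopCount_one]; norm_num
    rcases Nat.lt_or_ge (n + 1 + 1) (d + 1) with h | h
    · rw [loopCount_eq_zero h]; norm_num
    by_cases hn : n = 0
    · subst hn
      have := loopCount_le (0 + 1) (d + 1)
      have hd1 : d = 1 := by omega
      subst hd1
      norm_num at this ⊢
      linarith
    have hN : (0 : ℝ) < 2 * n + 1 := by positivity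
    have hdn : (d : ℝ) ≤ n + 1 := by exact_mod_cast (by omega : d ≤ n + 1)
    have hn1 : (1 : ℝ) ≤ n := by exact_mod_cast Nat.pos_of_ne_zero hn
    rw [loopCount_succ]
    have h1 := ih d
    have hco : (0 : ℝ) ≤ 1 - (d + 1) / (2 * n + 1) := by
      rw [sub_nonneg, div_le_one hN]; linarith
    have e1 := mul_le_mul_of_nonneg_right h1 hco
    have e2 : d * loopCount n d + (if d = 1 then 1 else 0) ≤ (2 : ℝ) := by
      split_ifs with h
      · subst h; rw [loopCount_one]; norm_num
      · obtain ⟨e, rfl⟩ := Nat.exists_eq_succ_of_ne_zero hd.ne'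
        have := ih e
        push_cast
        linarith
    have e3 : (d + 1) * (loopCount n d * (d / (2 * n + 1)) +
        if d = 1 then 1 / (2 * (n : ℝ) + 1) else 0) ≤ (d + 1) * (2 / (2 * n + 1)) := by
      gcongr
      have : loopCount n d * (d / (2 * n + 1)) + (if d = 1 then 1 / (2 * (n : ℝ) + 1) else 0) =
          (d * loopCount n d + (if d = 1 then 1 else 0)) / (2 * n + 1) := by
        split_ifs <;> ring
      rw [this]
      gcongr
    have e4 : 2 * (1 - ((d : ℝ) + 1) / (2 * n + 1)) + (d + 1) * (2 / (2 * n + 1)) = 2 := by ring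
    linarith

/-- The limiting proportion of vertices of degree `d`. -/
noncomputable def degreeDensity (d : ℕ) : ℝ := 4 / (d * (d + 1) * (d + 2))

theorem abs_plainCount_sub_le (n d : ℕ) :
    |(d + 1) * (plainCount n (d + 1) - (n + 1 / 2) * degreeDensity (d + 1))| ≤ 1 := by
  induction n generalizing d with
  | zero =>
    rw [plainCount_eq_zero (by omega), degreeDensity, abs_le]
    have : ((d : ℝ) + 1) * (1 / 2 * (4 / ((d + 1) * (d + 1 + 1) * (d + 1 + 2)))) ≤ 1 := by
      rw [show ((d : ℝ) + 1) * (1 / 2 * (4 / ((d + 1) * (d + 1 + 1) * (d + 1 + 2)))) =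
        2 / ((d + 1 + 1) * (d + 1 + 2)) by field_simp; ring, div_le_one (by positivity)]
      nlinarith [(Nat.cast_nonneg d : (0 : ℝ) ≤ d)]
    have h0 : (0 : ℝ) ≤ (d + 1) * (1 / 2 * (4 / ((d + 1) * (d + 1 + 1) * (d + 1 + 2)))) := by
      positivity
    push_cast
    constructor <;> linarith
  | succ n ih =>
    have hN : (0 : ℝ) < 2 * n + 1 := by positivity
    rcases Nat.lt_or_ge (2 * n + 1) (d + 1) with h | h
    · rw [plainCount_eq_zero (by omega), degreeDensity, abs_le]
      have hd : 2 * (n : ℝ) + 1 ≤ d := by exact_mod_cast (by omega : 2 * n + 1 ≤ d)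
      have e : ((d : ℝ) + 1) * ((n + 1 + 1 / 2) * (4 / ((d + 1) * (d + 1 + 1) * (d + 1 + 2)))) =
        (4 * n + 6) / ((d + 1 + 1) * (d + 1 + 2)) := by field_simp; ring
      have : ((d : ℝ) + 1) * ((n + 1 + 1 / 2) * (4 / ((d + 1) * (d + 1 + 1) * (d + 1 + 2)))) ≤ 1 := by
        rw [e, div_le_one (by positivity)]
        nlinarith [(Nat.cast_nonneg d : (0 : ℝ) ≤ d)]
      have h0 : 0 ≤ ((d : ℝ) + 1) *
        ((n + 1 + 1 / 2) * (4 / ((d + 1) * (d + 1 + 1) * (d + 1 + 2)))) := by positivity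
      push_cast
      constructor <;> linarith
    · have hdn : (d : ℝ) + 1 ≤ 2 * n + 1 := by exact_mod_cast h
      have hco : (0 : ℝ) ≤ 1 - (d + 1) / (2 * n + 1) := by
        rw [sub_nonneg, div_le_one hN]; exact hdn
      -- The weighted error is updated by a convex combination. The value -1 for d = 0 is the defect
      -- of the source 2n / (2n + 1) from 1, times 2n + 1.
      have key : (d + 1) * (plainCount (n + 1) (d + 1) -
          ((n + 1 : ℕ) + 1 / 2) * degreeDensity (d + 1)) =
          (d + 1) * (plainCount n (d + 1) - (n + 1 / 2) * degreeDensity (d + 1)) *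
            (1 - (d + 1) / (2 * n + 1)) + (d + 1) / (2 * n + 1) *
            (if d = 0 then -1 else d * (plainCount n d - (n + 1 / 2) * degreeDensity d)) := by
        rw [plainCount_succ]
        split_ifs with hd
        · subst hd
          rw [degreeDensity]
          push_cast
          field_simp
          ring
        · have : (d : ℝ) ≠ 0 := by exact_mod_cast hd
          rw [degreeDensity, degreeDensity]
          push_cast
          field_simp
          ring
      have e1 : |if d = 0 then -1 else d * (plainCount n d - (n + 1 / 2) * degreeDensity d)| ≤ 1 := by
        split_ifs with hd
        · norm_num
        · obtain ⟨e, rfl⟩ := Nat.exists_eq_succ_of_ne_zero hd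
          simpa using ih e
      rw [key]
      refine (abs_add_le _ _).trans ?_
      rw [abs_mul, abs_mul (((d : ℝ) + 1) / (2 * n + 1)), abs_of_nonneg hco,
        abs_of_nonneg (by positivity : (0 : ℝ) ≤ (d + 1) / (2 * n + 1))]
      have e2 := mul_le_mul_of_nonneg_right (ih d) hco
      have e3 := mul_le_mul_of_nonneg_left e1 (by positivity : (0 : ℝ) ≤ (d + 1) / (2 * n + 1))
      linarith

/-- A bound for the joint counts by a supersolution of their recursion. -/
theorem jointCount_le_of_supersolution {κ : ℤ} (hκ : -2 ≤ κ) {w : ℕ → ℝ} (hw : ∀ d, 0 ≤ w d)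
    (hbase : ∀ n d k, n ≤ 2 → jointCount n κ d k ≤ w d)
    (hS : ∀ n d k, d * w d + jointSource n κ (d + 1) k ≤ (d + 2) * w (d + 1))
    (hS0 : ∀ n d, d * w d + jointSource n κ (d + 1) 0 ≤ (2 * (d + 1) + κ) * w (d + 1))
    (hsign : ∀ d : ℕ, w (d + 1) = 0 ∨ -1 ≤ d + κ) (n d k : ℕ) : jointCount n κ d k ≤ w d := by
  induction n generalizing d k with
  | zero => exact hbase 0 d k (by norm_num)
  | succ n ih =>
    rcases Nat.lt_or_ge 2 (n + 1) with hn | hn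
    swap
    · exact hbase _ d k hn
    cases d with
    | zero => rw [jointCount_zero_left]; exact hw 0
    | succ d =>
    rcases lt_or_ge (2 * ((n + 1 : ℕ) : ℤ)) (2 * (d + 1 : ℕ) + k + κ) with h | h
    · rw [jointCount_eq_zero h]; exact hw _
    have hN : (0 : ℝ) < 2 * n + 1 := by positivity
    have ihd := mul_le_mul_of_nonneg_left (ih d k) (Nat.cast_nonneg (α := ℝ) d)
    rw [jointCount_succ]
    rcases le_or_gt (2 * ((d + 1 : ℕ) : ℤ) + k + κ) (2 * n + 1) with h1 | h1
    · have h1' : (2 * ((d : ℝ) + 1) + k + κ) ≤ 2 * n + 1 := by exact_mod_cast h1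
      have hco : (0 : ℝ) ≤ 1 - (2 * (d + 1) + k + κ) / (2 * n + 1) := by
        rw [sub_nonneg, div_le_one hN]; exact h1'
      have e1 := mul_le_mul_of_nonneg_right (ih (d + 1) k) hco
      have e2 : d * jointCount n κ d k +
          (if k = 0 then 0 else (d + k + κ) * jointCount n κ (d + 1) (k - 1)) +
            jointSource n κ (d + 1) k ≤ (2 * (d + 1) + k + κ) * w (d + 1) := by
        split_ifs with hk
        · subst hk
          have := hS0 n d
          push_cast
          linarith
        · have e3 : (d + k + κ) * jointCount n κ (d + 1) (k - 1) ≤ (d + k + κ) * w (d + 1) := by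
            have i1 := ih (d + 1) (k - 1)
            -- The inflow rate d + k + κ is negative only for κ = -2, d = 0, k = 1; there the weight
            -- must vanish, so that the bound is an equality.
            rcases hsign d with h2 | h2
            · have : jointCount n κ (d + 1) (k - 1) = w (d + 1) :=
                le_antisymm i1 (h2 ▸ jointCount_nonneg _ _ _ _)
              rw [this]
            · refine mul_le_mul_of_nonneg_left i1 ?_
              exact_mod_cast (by omega : 0 ≤ (d : ℤ) + k + κ)
          have := hS n d k
          linarith
      have e4 := div_le_div_of_nonneg_right e2 hN.le
      have e5 : (d * jointCount n κ d k +
          (if k = 0 then 0 else (d + k + κ) * jointCount n κ (d + 1) (k - 1)) +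
            jointSource n κ (d + 1) k) / (2 * n + 1) = jointCount n κ d k * (d / (2 * n + 1)) +
          (if k = 0 then 0 else jointCount n κ (d + 1) (k - 1) * ((d + k + κ) / (2 * n + 1))) +
          jointSource n κ (d + 1) k / (2 * n + 1) := by
        split_ifs <;> ring
      have e6 : w (d + 1) * (1 - (2 * (d + 1) + k + κ) / (2 * n + 1)) +
        (2 * (d + 1) + k + κ) * w (d + 1) / (2 * n + 1) = w (d + 1) := by ring
      linarith
    -- Here 2(d + 1) + k + κ = 2n + 2, so the staying coefficient is negative, but the counts at k
    -- and k - 1 vanish. The remaining inequality d + 2 ≤ 2n + 1 needs n ≥ 2, which is why `hbase`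
    -- covers n ≤ 2.
    · rw [jointCount_eq_zero (n := n) (d := d + 1) (k := k) (by omega)]
      have e1 : (if k = 0 then 0 else
          jointCount n κ (d + 1) (k - 1) * (((d : ℝ) + k + κ) / (2 * n + 1))) = 0 := by
        split_ifs with hk
        · rfl
        · rw [jointCount_eq_zero (by omega), zero_mul]
      have hdn : (d : ℝ) + 2 ≤ 2 * n + 1 := by exact_mod_cast (by omega : d + 2 ≤ 2 * n + 1)
      have e2 := mul_le_mul_of_nonneg_right hdn (hw (d + 1))
      have e3 := hS n d k
      have e4 : (d * jointCount n κ d k + jointSource n κ (d + 1) k) / (2 * n + 1) ≤ w (d + 1) := by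
        rw [div_le_iff₀ hN]; linarith
      have e5 : (d * jointCount n κ d k + jointSource n κ (d + 1) k) / (2 * n + 1) =
        jointCount n κ d k * (d / (2 * n + 1)) + jointSource n κ (d + 1) k / (2 * n + 1) := by ring
      rw [e1]
      linarith

/-- The constant 40 is 2 * 4 * 5, the largest n times the largest d(d + 1) in this range. -/
theorem natCast_le_weight {n d : ℕ} (hn : n ≤ 2) (hd : d ≤ 2 * n) (hd0 : d ≠ 0) :
    (n : ℝ) ≤ 40 / (d * (d + 1)) := by
  have h1 : (n : ℝ) ≤ 2 := by exact_mod_cast hn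
  have h2 : (d : ℝ) ≤ 4 := by exact_mod_cast (by omega : d ≤ 4)
  have h3 : (0 : ℝ) < d := by exact_mod_cast Nat.pos_of_ne_zero hd0
  rw [le_div_iff₀ (by positivity)]
  have : (d : ℝ) * (d + 1) ≤ 4 * (4 + 1) := by gcongr
  nlinarith

theorem weight_telescope (d : ℕ) :
    d * (40 / ((d : ℝ) * (d + 1))) + (if d = 0 then 40 else 0) =
      (d + 2) * (40 / (((d + 1 : ℕ) : ℝ) * ((d + 1 : ℕ) + 1))) := by
  rcases Nat.eq_zero_or_pos d with rfl | hd
  · norm_num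
  · have : (d : ℝ) ≠ 0 := by positivity
    rw [if_neg hd.ne']
    push_cast
    field_simp
    ring

theorem jointCount_one_le (n d k : ℕ) : jointCount n 1 d k ≤ 40 / (d * (d + 1)) := by
  have hS : ∀ n d k : ℕ, d * (40 / ((d : ℝ) * (d + 1))) + jointSource n 1 (d + 1) k ≤
      (d + 2) * (40 / (((d + 1 : ℕ) : ℝ) * ((d + 1 : ℕ) + 1))) := by
    intro n d k
    rw [← weight_telescope, jointSource_one]
    have := succ_mul_loopCount_le n k
    split_ifs <;> linarith
  refine jointCount_le_of_supersolution (by norm_num) (w := fun d => 40 / ((d : ℝ) * (d + 1)))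
    (fun d => by positivity) ?_ hS ?_ (fun d => Or.inr (by omega)) n d k
  · intro n d k hn
    by_cases hd0 : d = 0
    · subst hd0; rw [jointCount_zero_left]; positivity
    by_cases hd : d ≤ 2 * n
    · exact (jointCount_le n 1 d k).trans (natCast_le_weight hn hd hd0)
    · rw [jointCount_degree_eq_zero (by omega)]; positivity
  · intro n d
    refine (hS n d 0).trans (mul_le_mul_of_nonneg_right ?_ (by positivity))
    push_cast
    linarith [(Nat.cast_nonneg d : (0 : ℝ) ≤ d)]

theorem jointCount_neg_two_le (n d k : ℕ) : jointCount n (-2) d k ≤ 40 / (d * (d + 1)) := by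
  have hpos : ∀ d : ℕ, 0 ≤ if d ≤ 1 then 0 else 40 / ((d : ℝ) * (d + 1)) := fun d => by
    split_ifs <;> positivity
  refine (jointCount_le_of_supersolution (le_refl _)
    (w := fun d => if d ≤ 1 then 0 else 40 / ((d : ℝ) * (d + 1))) hpos ?_ ?_ ?_ ?_ n d k).trans ?_
  · intro n d k hn
    by_cases hd1 : d ≤ 1
    · rw [if_pos hd1]
      obtain rfl | rfl : d = 0 ∨ d = 1 := by omega
      · rw [jointCount_zero_left]
      · rw [jointCount_neg_two_one]
    rw [if_neg hd1]
    by_cases hd : d ≤ 2 * n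
    · exact (jointCount_le n _ d k).trans (natCast_le_weight hn hd (by omega))
    · rw [jointCount_degree_eq_zero (by omega)]; positivity
  · intro n d k
    rw [jointSource_neg_two]
    rcases lt_trichotomy d 1 with h | rfl | h
    · obtain rfl : d = 0 := by omega
      norm_num
    · norm_num
      split_ifs <;> norm_num
    · have := weight_telescope d
      rw [if_neg (by omega)] at this
      rw [if_neg (by omega), if_neg (by omega), if_neg (by omega)]
      linarith
  · intro n d
    rw [jointSource_neg_two]
    rcases lt_trichotomy d 1 with h | rfl | h
    · obtain rfl : d = 0 := by omega
      norm_num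
    · norm_num
    · have := weight_telescope d
      rw [if_neg (by omega)] at this
      rw [if_neg (by omega), if_neg (by omega), if_neg (by omega)]
      rw [add_zero] at this ⊢
      rw [this]
      refine mul_le_mul_of_nonneg_right ?_ (by positivity)
      have : (2 : ℝ) ≤ d := by exact_mod_cast h
      push_cast
      linarith
  · intro d
    rcases Nat.eq_zero_or_pos d with rfl | hd
    · left; simp
    · right; omega
  · show (if d ≤ 1 then 0 else 40 / ((d : ℝ) * (d + 1))) ≤ _
    split_ifs
    · positivity
    · exact le_rfl

theorem limitDensity.succ_left (d k : ℕ) :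
    (2 * d + k + 4) * limitDensity (d + 1) k = d * limitDensity d k +
      (if k = 0 then 0 else (d + k) * limitDensity (d + 1) (k - 1)) +
        if d = 0 then birthRate k else 0 := by
  cases k with
  | zero => simp [birthRate]
  | succ k =>
    have := limitDensity.succ_succ d k
    rw [if_neg (Nat.succ_ne_zero k), Nat.add_sub_cancel]
    push_cast
    linarith

/-- The joint counts of the vertices joined to a vertex without a loop are within a bounded
distance, summable in the degree, of their limit. -/
theorem abs_jointCount_sub_le (n d k : ℕ) :
    |jointCount n 0 (d + 1) k - (n + 1 / 2) * limitDensity (d + 1) k| ≤ 4 / ((d + 1) * (d + 2)) := by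
  -- No vertex of class 0 reaches this range, so the error is the limit term alone, and `le_size`
  -- compensates the factor n + 1/2.
  have hbig : ∀ n d k : ℕ, 2 * n ≤ 2 * (d + 1) + k →
      |jointCount n 0 (d + 1) k - (n + 1 / 2) * limitDensity (d + 1) k| ≤
        4 / ((d + 1) * (d + 2)) := by
    intro n d k h
    have h1 : (2 * n : ℝ) ≤ 2 * (d + 1) + k := by exact_mod_cast h
    rw [jointCount_eq_zero_of_le h, zero_sub, abs_neg,
      abs_of_nonneg (mul_nonneg (by positivity) (limitDensity.nonneg _ _))]
    calc (n + 1 / 2) * limitDensity (d + 1) k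
        ≤ (2 * d + k + 4) * (4 / ((d + 1) * (d + 2) * (2 * d + k + 4))) := by
          refine mul_le_mul (by linarith [(Nat.cast_nonneg n : (0 : ℝ) ≤ n)])
            (limitDensity.le_size d k) (limitDensity.nonneg _ _) (by positivity)
      _ = _ := by field_simp
  induction n generalizing d k with
  | zero => exact hbig 0 d k (by omega)
  | succ n ih =>
    -- The strict inequality in the first case of `Admissible` puts the value 2n + 2 under `hbig`;
    -- otherwise the staying coefficient is nonnegative.
    rcases Nat.lt_or_ge (2 * n + 1) (2 * (d + 1) + k) with h | h
    · exact hbig _ d k (by omega)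
    have hN : (0 : ℝ) < 2 * n + 1 := by positivity
    have h' : 2 * ((d : ℝ) + 1) + k ≤ 2 * n + 1 := by exact_mod_cast h
    have hco : (0 : ℝ) ≤ 1 - (2 * (d + 1) + k) / (2 * n + 1) := by
      rw [sub_nonneg, div_le_one hN]; exact h'
    set E : ℕ → ℕ → ℝ := fun d k => jointCount n 0 d k - (n + 1 / 2) * limitDensity d k with hE
    have key : jointCount (n + 1) 0 (d + 1) k - ((n + 1 : ℕ) + 1 / 2) * limitDensity (d + 1) k =
        E (d + 1) k * (1 - (2 * (d + 1) + k) / (2 * n + 1)) +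
        (d * E d k + (if k = 0 then 0 else (d + k) * E (d + 1) (k - 1)) +
          if d = 0 then k * plainCount n k - (n + 1 / 2) * birthRate k else 0) / (2 * n + 1) := by
      have h1 := limitDensity.succ_left d k
      rw [jointCount_succ, jointSource_zero]
      simp only [hE]
      push_cast
      split_ifs at h1 ⊢ <;> field_simp <;> linear_combination (-(1 : ℝ) * (2 * n + 1)) * h1
    have i1 : |E (d + 1) k| ≤ 4 / ((d + 1) * (d + 2)) := ih d k
    have i2 : |(d : ℝ) * E d k| + (if d = 0 then 4 else 0) ≤ 4 / (d + 1) := by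
      rcases Nat.eq_zero_or_pos d with rfl | hd
      · simp
      · obtain ⟨e, rfl⟩ := Nat.exists_eq_succ_of_ne_zero hd.ne'
        rw [if_neg hd.ne', abs_mul, Nat.abs_cast, add_zero]
        have := mul_le_mul_of_nonneg_left (ih e k) (by positivity : (0 : ℝ) ≤ e + 1)
        push_cast
        refine this.trans (le_of_eq ?_)
        field_simp
        ring
    have i3 : |if k = 0 then 0 else ((d : ℝ) + k) * E (d + 1) (k - 1)| ≤
        (d + k) * (4 / ((d + 1) * (d + 2))) := by
      split_ifs
      · rw [abs_zero]; positivity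
      · rw [abs_mul, abs_of_nonneg (by positivity : (0 : ℝ) ≤ d + k)]
        exact mul_le_mul_of_nonneg_left (ih d (k - 1)) (by positivity)
    have i4 : |if d = 0 then k * plainCount n k - (n + 1 / 2) * birthRate k else 0| ≤
        if d = 0 then (4 : ℝ) else 0 := by
      split_ifs
      · cases k with
        | zero => simp [birthRate]
        | succ k =>
          have := abs_plainCount_sub_le n k
          have e : ((k + 1 : ℕ) : ℝ) * plainCount n (k + 1) - (n + 1 / 2) * birthRate (k + 1) =
              (k + 1) * (plainCount n (k + 1) - (n + 1 / 2) * degreeDensity (k + 1)) := by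
            rw [limitDensity.birthRate_succ, degreeDensity]
            push_cast
            field_simp
            ring
          rw [e]
          linarith
      · rw [abs_zero]
    rw [key]
    refine (abs_add_le _ _).trans ?_
    rw [abs_mul, abs_of_nonneg hco, abs_div, abs_of_pos hN]
    have j1 := mul_le_mul_of_nonneg_right i1 hco
    have j2 := (abs_add_three ((d : ℝ) * E d k)
      (if k = 0 then 0 else ((d : ℝ) + k) * E (d + 1) (k - 1))
      (if d = 0 then k * plainCount n k - (n + 1 / 2) * birthRate k else 0))
    -- Inflow from d (or the source, when d = 0) costs d + 2 times the weight and inflow from k - 1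
    -- costs d + k times it: together exactly the loss rate 2(d + 1) + k.
    have j3 : 4 / ((d : ℝ) + 1) = (d + 2) * (4 / ((d + 1) * (d + 2))) := by field_simp
    have j4 : |(d : ℝ) * E d k + (if k = 0 then 0 else ((d : ℝ) + k) * E (d + 1) (k - 1)) +
      (if d = 0 then k * plainCount n k - (n + 1 / 2) * birthRate k else 0)| / (2 * n + 1) ≤
      (2 * (d + 1) + k) * (4 / ((d + 1) * (d + 2))) / (2 * n + 1) := by
      gcongr
      linarith
    have j5 : (4 / (((d : ℝ) + 1) * (d + 2))) * (1 - (2 * (d + 1) + k) / (2 * n + 1)) +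
      (2 * (d + 1) + k) * (4 / ((d + 1) * (d + 2))) / (2 * n + 1) = 4 / ((d + 1) * (d + 2)) := by
      ring
    linarith

/-! ### Summation over the degree and the final estimate -/

theorem expectedSecondDegree_eq (n k : ℕ) {D : ℕ} (hD : 2 * n ≤ D) :
    expectedSecondDegree n k = ∑ d ∈ Finset.range D, (jointCount n 0 (d + 1) k +
      jointCount n 1 (d + 1) k + jointCount n (-2) (d + 1) k) := by
  have h : expectedSecondDegree n k = vertexMean n fun _ k' _ => if k' = k then 1 else 0 := by
    rw [expectedSecondDegree, tsum_prefAttach, vertexMean]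
    congr 1
    funext G
    rw [numSecondDegree, Finset.card_filter]
    push_cast
    rfl
  rw [h]
  simp only [jointCount, ← vertexMean.add]
  rw [← vertexMean.sum]
  refine vertexMean.congr n fun d' k' K' ha => ?_
  rw [Admissible] at ha
  rw [Finset.sum_eq_single (d' - 1)]
  · have hd : d' - 1 + 1 = d' := by omega
    rw [hd]
    by_cases hk : k' = k
    · subst hk
      rw [if_pos rfl]
      rcases ha.2.2 with h | h | h
      · rw [if_pos (by omega), if_neg (by omega), if_neg (by omega)]; norm_num
      · rw [if_neg (by omega), if_pos (by omega), if_neg (by omega)]; norm_num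
      · rw [if_neg (by omega), if_neg (by omega), if_pos (by omega)]; norm_num
    · rw [if_neg hk, if_neg (by omega), if_neg (by omega), if_neg (by omega)]; norm_num
  · intro b _ hb
    rw [if_neg (by omega), if_neg (by omega), if_neg (by omega)]; norm_num
  · intro hb
    rw [Finset.mem_range] at hb
    omega

/-- 84 = 4 + 40 + 40, one term for each class; the sum of 1 / ((d + 1)(d + 2)) is at most 1. -/
theorem abs_expectedSecondDegree_sub_le (n k : ℕ) {D : ℕ} (hD : 2 * n ≤ D) :
    |expectedSecondDegree n k - (n + 1 / 2) * limitDensity.mass D k| ≤ 84 := by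
  rw [expectedSecondDegree_eq n k hD, limitDensity.mass, Finset.mul_sum, ← Finset.sum_sub_distrib]
  refine (Finset.abs_sum_le_sum_abs _ _).trans ?_
  have h : ∀ d ∈ Finset.range D, |jointCount n 0 (d + 1) k + jointCount n 1 (d + 1) k +
      jointCount n (-2) (d + 1) k - (n + 1 / 2) * limitDensity (d + 1) k| ≤
      84 / ((d + 1) * (d + 2)) := by
    intro d _
    have h0 := abs_jointCount_sub_le n d k
    have h1 := jointCount_one_le n (d + 1) k
    have h2 := jointCount_neg_two_le n (d + 1) k
    have h1' := jointCount_nonneg n 1 (d + 1) k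
    have h2' := jointCount_nonneg n (-2) (d + 1) k
    have e : (84 : ℝ) / ((d + 1) * (d + 2)) = 4 / ((d + 1) * (d + 2)) +
      40 / (((d + 1 : ℕ) : ℝ) * ((d + 1 : ℕ) + 1)) + 40 / (((d + 1 : ℕ) : ℝ) * ((d + 1 : ℕ) + 1)) := by
      push_cast
      field_simp
      ring
    rw [e]
    rw [abs_le] at h0 ⊢
    constructor <;> linarith [h0.1, h0.2]
  refine (Finset.sum_le_sum h).trans ?_
  have : ∀ D : ℕ, ∑ d ∈ Finset.range D, (84 : ℝ) / ((d + 1) * (d + 2)) = 84 - 84 / (D + 1) := by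
    intro D
    induction D with
    | zero => simp
    | succ D ih =>
      rw [Finset.sum_range_succ, ih]
      push_cast
      field_simp
      ring
  rw [this]
  have : (0 : ℝ) ≤ 84 / (D + 1) := by positivity
  linarith

theorem abs_expectedSecondDegree_sub_main_le {n k : ℕ} (hn : 1 ≤ n) (hk : 1 ≤ k) :
    |expectedSecondDegree n k - 4 * n / k ^ 2| ≤
      60 * (n * limitDensity.harm k ^ 2 / k ^ 3) + 89 := by
  have hk' : (1 : ℝ) ≤ k := by exact_mod_cast hk
  have hn' : (1 : ℝ) ≤ n := by exact_mod_cast hn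
  -- The cutoff exceeds every possible degree, is at least k as `mass_asymptotic` requires, and is
  -- at least n, so that the cutoff error is at most 4/n.
  have h1 := abs_expectedSecondDegree_sub_le n k (D := 2 * n + k) (by omega)
  have h2 := limitDensity.mass_asymptotic (D := 2 * n + k) hk (by omega)
  have h3 := limitDensity.mass_le (2 * n + k) k
  have h3' : 0 ≤ limitDensity.mass (2 * n + k) k :=
    Finset.sum_nonneg fun _ _ => limitDensity.nonneg _ _
  have h4 := limitDensity.one_le_harm hk
  set f := limitDensity.mass (2 * n + k) k
  set H := limitDensity.harm k
  have hD : (n : ℝ) ≤ (2 * n + k : ℕ) := by push_cast; linarith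
  have h5 : |f - 4 / k ^ 2| ≤ 60 * (H ^ 2 / k ^ 3) + 4 / n := by
    have e0 : (0 : ℝ) < k * (k + 1) * (k + 2) := by positivity
    have e1 : f - 4 / k ^ 2 = (k * (k + 1) * (k + 2) * f - 4 * k) / (k * (k + 1) * (k + 2)) -
        (12 * k + 8) / (k ^ 2 * (k + 1) * (k + 2)) := by
      field_simp
      ring
    have e2 : (12 * (k : ℝ) + 8) / (k ^ 2 * (k + 1) * (k + 2)) ≤ 12 * (H ^ 2 / k ^ 3) := by
      calc (12 * (k : ℝ) + 8) / (k ^ 2 * (k + 1) * (k + 2)) ≤ 12 * (1 / k ^ 3) := by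
            rw [mul_one_div, div_le_div_iff₀ (by positivity) (by positivity)]
            have : 0 ≤ (k : ℝ) ^ 2 * k := by positivity
            nlinarith
        _ ≤ _ := by gcongr; exact one_le_pow₀ h4
    have e2' : 0 ≤ (12 * (k : ℝ) + 8) / (k ^ 2 * (k + 1) * (k + 2)) := by positivity
    have e3 : |(k * (k + 1) * (k + 2) * f - 4 * k) / (k * (k + 1) * (k + 2))| ≤
        48 * (H ^ 2 / k ^ 3) + 4 / n := by
      rw [abs_div, abs_of_pos e0]
      refine (div_le_div_of_nonneg_right h2 e0.le).trans ?_
      rw [add_div]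
      refine add_le_add ?_ ?_
      · rw [mul_div_assoc]
        gcongr
        nlinarith
      · calc 4 * (k : ℝ) * (k * (k + 1)) / ((2 * n + k : ℕ) : ℝ) ^ 3 / (k * (k + 1) * (k + 2))
            = 4 * (k / (k + 2)) / ((2 * n + k : ℕ) : ℝ) ^ 3 := by field_simp
          _ ≤ 4 * 1 / (n : ℝ) ^ 3 := by
            gcongr
            rw [div_le_one (by positivity)]; linarith
          _ ≤ 4 / n := by
            rw [mul_one]
            gcongr
            exact le_self_pow₀ hn' (by norm_num)
    rw [e1]
    refine (abs_sub _ _).trans ?_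
    rw [abs_of_nonneg e2']
    linarith
  have e : expectedSecondDegree n k - 4 * n / k ^ 2 =
      (expectedSecondDegree n k - (n + 1 / 2) * f) + (n * (f - 4 / k ^ 2) + f / 2) := by ring
  have h6 : |(n : ℝ) * (f - 4 / k ^ 2)| ≤ 60 * (n * H ^ 2 / k ^ 3) + 4 := by
    rw [abs_mul, Nat.abs_cast]
    refine (mul_le_mul_of_nonneg_left h5 (by positivity)).trans (le_of_eq ?_)
    field_simp
  rw [e]
  rw [abs_le] at h1 h6 ⊢
  -- 89 = 84 + 4 + 1, the last term bounding half the mass, which comes from the 1/2 in n + 1/2.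
  constructor <;> linarith [h1.1, h1.2, h6.1, h6.2]

theorem harm_sq_le_log_sq {k : ℕ} (hk : 1 < k) :
    limitDensity.harm k ^ 2 ≤ 9 * Real.log k ^ 2 := by
  have h1 := limitDensity.harm_le k
  have h2 : Real.log 2 ≤ Real.log k := Real.log_le_log (by norm_num) (by exact_mod_cast hk)
  have h3 := Real.log_two_gt_d9
  have h4 := limitDensity.harm_nonneg k
  -- As k ≥ 2 and ln 2 > 1/2, the constant 1 in `harm_le` is at most 2 ln k.
  have : limitDensity.harm k ≤ 3 * Real.log k := by linarith
  nlinarith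

/-- An error that is at most the sum of two bounds splits into two errors. -/
theorem exists_split {r a b : ℝ} (ha : 0 ≤ a) (hb : 0 < b) (h : |r| ≤ a + b) :
    ∃ r₁ r₂ : ℝ, |r₁| ≤ a ∧ |r₂| ≤ b ∧ r = r₁ + r₂ := by
  have hab : 0 < a + b := by linarith
  refine ⟨a * (r / (a + b)), b * (r / (a + b)), ?_, ?_, by field_simp⟩
  all_goals
    have : |r / (a + b)| ≤ 1 := by rwa [abs_div, abs_of_pos hab, div_le_one hab]
    rw [abs_mul]
  · rw [abs_of_nonneg ha]; nlinarith
  · rw [abs_of_pos hb]; nlinarith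

theorem theorem2 :
    ∃ C : ℝ, ∀ n k : ℕ, 1 ≤ n → 1 < k →
      ∃ θ₁ θ₂ : ℝ,
        |θ₁| ≤ C * (Real.log k ^ 2 / k) ∧
        |θ₂| ≤ C * ((k : ℝ) ^ 2 / n) ∧
        expectedSecondDegree n k = 4 * (n : ℝ) / (k : ℝ) ^ 2 * (1 + θ₁ + θ₂) := by
  -- 135 = 60 * 9 / 4: dividing by the main term 4n/k² turns 540 into 135 and 89 into 89/4.
  refine ⟨135, fun n k hn hk => ?_⟩
  have hk0 : (0 : ℝ) < k := by exact_mod_cast (by omega : 0 < k)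
  have hn0 : (0 : ℝ) < n := by exact_mod_cast (by omega : 0 < n)
  have h := abs_expectedSecondDegree_sub_main_le hn hk.le
  have hH : 60 * (n * limitDensity.harm k ^ 2 / k ^ 3) ≤ 540 * (n * Real.log k ^ 2 / k ^ 3) := by
    have : 60 * (n * limitDensity.harm k ^ 2 / (k : ℝ) ^ 3) ≤
        60 * (n * (9 * Real.log k ^ 2) / k ^ 3) := by
      gcongr
      exact harm_sq_le_log_sq hk
    refine this.trans (le_of_eq (by ring))
  obtain ⟨r₁, r₂, h1, h2, h3⟩ := exists_split (by positivity) (by norm_num)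
    (h.trans (add_le_add_left hH 89))
  have hc : (0 : ℝ) < k ^ 2 / (4 * n) := by positivity
  refine ⟨r₁ * (k ^ 2 / (4 * n)), r₂ * (k ^ 2 / (4 * n)), ?_, ?_, ?_⟩
  · rw [abs_mul, abs_of_pos hc]
    refine (mul_le_mul_of_nonneg_right h1 hc.le).trans (le_of_eq ?_)
    field_simp
    ring
  · rw [abs_mul, abs_of_pos hc]
    refine (mul_le_mul_of_nonneg_right h2 hc.le).trans ?_
    have : 0 ≤ (k : ℝ) ^ 2 / n := by positivity
    have e : 89 * ((k : ℝ) ^ 2 / (4 * n)) = 89 / 4 * (k ^ 2 / n) := by field_simp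
    rw [e]
    linarith
  · rw [sub_eq_iff_eq_add] at h3
    rw [h3]
    field_simp
    ring
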